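/- Let $E$ be an elliptic curve over a finite field $\mathbf F_q$ of characteristic $p$. For integers $r\ge 1$ set $t_{q^r} := q^r+1-\#E(\mathbf F_{q^r})$ and $x_r := t_{q^r}/q^{r/2}$. Suppose that $E$ is ordinary, i.e. that $p \nmid t_q$. Then $x_r\in[-2,2]$ for every $r\ge 1$, and the sequence $(x_1,x_2,x_3,\ldots)$ is equidistributed in $[-2,2]$ with respect to the measure \[ \mu := \frac1\pi\,\frac{dz}{\sqrt{4-z^2}}, \] where $dz$ is Lebesgue measure on $[-2,2]$; that is, for every continuous function $f\colon[-2,2]\to\mathbf C$, \[ \lim_{n\to\infty}\frac1n\sum_{r=1}^n f(x_r)=\int_{-2}^{2} f(z)\,\mu = \frac1\pi\int_{-2}^{2}\frac{f(z)\,dz}{\sqrt{4-z^2}} . \] -/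

import Mathlib

open Filter Topology MeasureTheory

/-- The sequence `x 0, x 1, x 2, …` of points of `X` is equidistributed with respect to `μ`: for
every continuous `f : X → ℂ`, the mean of `f` over the first `n` terms tends to `∫ f dμ`. -/
def IsEquidistributed {X : Type*} [TopologicalSpace X] [MeasurableSpace X]
    (μ : Measure X) (x : ℕ → X) : Prop :=
  ∀ f : C(X, ℂ), Tendsto (fun n : ℕ => (1 / (n : ℂ)) * ∑ i ∈ Finset.range n, f (x i)) atTop
    (𝓝 (∫ z, f z ∂μ))

/-- The measure `(1/π) dz / √(4 - z²)` on `[-2, 2]`, where `dz` is Lebesgue measure. -/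
noncomputable def arcsineMeasure : Measure (Set.Icc (-2 : ℝ) 2) :=
  ((volume : Measure ℝ).comap (Subtype.val : Set.Icc (-2 : ℝ) 2 → ℝ)).withDensity fun z =>
    ENNReal.ofReal (1 / Real.pi * (1 / √(4 - (z : ℝ) ^ 2)))

namespace WeierstrassCurve

/-- `t_q = q + 1 - #E(F)` for a Weierstrass curve `E` over a finite field `F` with `q` elements. -/
noncomputable def frobeniusTrace {F : Type*} [Field F] (E : WeierstrassCurve F) : ℤ :=
  (Nat.card F : ℤ) + 1 - Nat.card E.toAffine.Point

/-- `t_{q ^ r} = q ^ r + 1 - #E(F_{q ^ r})` for `E` over a finite field `F` with `q` elements of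
characteristic `p` and `r ≥ 1`. Here `F_{q ^ r}` is the extension of `F` of degree `r`. -/
noncomputable def frobeniusTraceExt {F : Type*} [Field F] [Finite F] (p : ℕ) [Fact p.Prime]
    [CharP F p] (E : WeierstrassCurve F) (r : ℕ) [NeZero r] : ℤ :=
  (Nat.card F : ℤ) ^ r + 1 - Nat.card (E.baseChange (FiniteField.Extension F p r)).toAffine.Point

/-- The normalized trace `x_r = t_{q ^ r} / q ^ (r / 2)`. -/
noncomputable def normalizedTrace {F : Type*} [Field F] [Finite F] (p : ℕ) [Fact p.Prime]
    [CharP F p] (E : WeierstrassCurve F) (r : ℕ) [NeZero r] : ℝ :=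
  (E.frobeniusTraceExt p r : ℝ) / (Nat.card F : ℝ) ^ ((r : ℝ) / 2)

/-- `E` over a finite field of characteristic `p` is ordinary: `t_q` is not zero modulo `p`. -/
def IsOrdinary {F : Type*} [Field F] (p : ℕ) [CharP F p] (E : WeierstrassCurve F) : Prop :=
  ¬ (p : ℤ) ∣ E.frobeniusTrace

end WeierstrassCurve

/-!
Let `R` be the affine coordinate ring of `E` and `q` the order of `F`. It is a Dedekind domain
with finite residue fields (`isIntegrallyClosed`), so its zeta function, the generating function
of the number of ideals of each codimension, is an Euler product. The logarithmic derivative of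
the product counts the homomorphisms from `R` to the extensions of `F` (`mul_idealCount`,
`card_algHom_eq_sum_divisors`), which are the affine points of `E` (`card_point`). On the other
hand the Riemann–Roch theorem, needed only for ideals twisted by multiples of the point at
infinity, where it reduces to counting functions by degree
(`card_functionsInOfDegLE_codim_add_one`), determines the number of ideals of each codimension
(`idealCount_add_two`): the zeta function is `(1 - a T + q T ^ 2) / (1 - q T)` with `a = t_q`.
Hence `t_{q ^ r} = α ^ r + β ^ r`, where `α` and `β` are the roots of `x ^ 2 - a x + q`
(`frobeniusTraceExt_eq`).

Hasse's bound `a ^ 2 ≤ 4 q` says that `α` and `β` have absolute value `√q`. It follows from a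
one-sided bound `t_{q ^ (2 m)} ≤ 5 q ^ m`, since otherwise `α ^ (2 m) + β ^ (2 m)` grows faster
than `q ^ m`. The one-sided bound is a lower bound for the number of points over a field of square
order (`card_le_card_algHom_add`). Over every rational `x` there are two points which Frobenius
fixes or maps to their opposites, and Stepanov's method bounds the number of points of the second
kind (`card_frobeniusNegPoint_le`).

So `x_r = 2 cos (r θ)` for an angle `θ` (`normalizedTrace_eq_cos`). If `E` is ordinary, then `θ`
is not a rational multiple of `π`: otherwise `t_{q ^ r} = 2 q ^ (r / 2)` for some even `r`, which
is divisible by `p`, but `t_{q ^ r} ≡ a ^ r` modulo `p` (`cos_mul_ne_one`). The equidistribution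
is then Weyl's theorem for the multiples of `θ`: the means of `cos (k r θ)`, `k ≥ 1`, tend to zero
since they are geometric sums, the integrals of the Chebyshev polynomials `T_k(z / 2)` against the
arcsine measure vanish, and these polynomials span a dense subspace of the continuous functions
(`isEquidistributed_two_mul_cos`).
-/

/-! ### Counting ideals and points of a Dedekind algebra over a finite field -/

section DedekindAlgebra

open Module UniqueFactorizationMonoid

variable (F : Type*) {R : Type*} [Field F] [CommRing R] [Algebra F R]

/-- The codimension over `F` of an ideal of an `F`-algebra; it is `0` if the quotient is infinite
dimensional, in particular for the zero ideal in the rings considered here. -/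
noncomputable def Ideal.codim (I : Ideal R) : ℕ := finrank F (R ⧸ I)

variable (R) in
/-- The number of nonzero ideals of codimension `m`. -/
noncomputable def idealCount (m : ℕ) : ℕ := Nat.card {I : Ideal R // I ≠ ⊥ ∧ I.codim F = m}

variable (R) in
/-- The number of nonzero primes of degree `d`. -/
noncomputable def primeCount (d : ℕ) : ℕ :=
  Nat.card {P : Ideal R // (P.IsPrime ∧ P ≠ ⊥) ∧ P.codim F = d}

variable [Ring.HasFiniteQuotients R]

lemma card_quotient_eq_pow_codim {I : Ideal R} (hI : I ≠ ⊥) :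
    Nat.card (R ⧸ I) = Nat.card F ^ I.codim F := by
  have := Ring.HasFiniteQuotients.finiteQuotient hI
  exact Module.natCard_eq_pow_finrank

lemma codim_eq_zero_iff {I : Ideal R} (hI : I ≠ ⊥) : I.codim F = 0 ↔ I = ⊤ := by
  have := Ring.HasFiniteQuotients.finiteQuotient hI
  rw [Ideal.codim, finrank_zero_iff, Ideal.Quotient.subsingleton_iff]

variable (R) in
lemma codim_top [Nontrivial R] : (⊤ : Ideal R).codim F = 0 :=
  (codim_eq_zero_iff F (by simp)).2 rfl

variable (R) in
lemma finite_codim_eq (m : ℕ) : {I : Ideal R | I ≠ ⊥ ∧ I.codim F = m}.Finite := by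
  refine (Ring.HasFiniteQuotients.finite_cardQuot_le (R := R) (Nat.card F ^ m)).subset ?_
  rintro I ⟨hI, rfl⟩
  exact (card_quotient_eq_pow_codim F hI).le

variable (R) in
lemma idealCount_zero [Nontrivial R] : idealCount F R 0 = 1 := by
  rw [idealCount, Nat.card_eq_one_iff_unique]
  refine ⟨⟨fun I J => Subtype.ext ?_⟩, ⟨⟨⊤, by simp, codim_top F R⟩⟩⟩
  rw [(codim_eq_zero_iff F I.2.1).1 I.2.2, (codim_eq_zero_iff F J.2.1).1 J.2.2]

variable {F} in
lemma codim_pos {P : Ideal R} (hP : P ≠ ⊥) (h : P ≠ ⊤) : 0 < P.codim F :=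
  Nat.pos_of_ne_zero fun h0 => h ((codim_eq_zero_iff F hP).1 h0)

variable [Finite F] [IsDedekindDomain R]

/-- In a Dedekind domain `I / IJ` is isomorphic to `R / J`. -/
lemma codim_mul {I J : Ideal R} (hI : I ≠ ⊥) (hJ : J ≠ ⊥) :
    (I * J).codim F = I.codim F + J.codim F := by
  have hIJ : I * J ≠ ⊥ := mul_ne_zero hI hJ
  apply Nat.pow_right_injective (Finite.one_lt_card : 2 ≤ Nat.card F)
  simp only
  rw [pow_add, ← card_quotient_eq_pow_codim F hIJ, ← card_quotient_eq_pow_codim F hI,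
    ← card_quotient_eq_pow_codim F hJ,
    ← Submodule.card_quotient_mul_card_quotient I (I * J) Ideal.mul_le_left, mul_comm]
  congr 1
  obtain ⟨a, ha⟩ := IsDedekindDomain.exists_sup_span_eq (Ideal.mul_le_left : I * J ≤ I) hIJ
  have haI : a ∈ I := ha ▸ Ideal.mem_sup_right (Ideal.mem_span_singleton_self a)
  obtain ⟨A, hA⟩ := Ideal.dvd_span_singleton.2 haI
  have hco : J ⊔ A = ⊤ := by
    rw [hA, ← Ideal.add_eq_sup, ← mul_add] at ha
    have := mul_left_cancel₀ (b := J + A) (c := 1) hI (by rw [ha, mul_one])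
    simpa using this
  let f : R →ₗ[R] R ⧸ (I * J) := (LinearMap.toSpanSingleton R _ ((I * J).mkQ a))
  have hrange : LinearMap.range f = Submodule.map (I * J).mkQ I := by
    have h := congrArg (Submodule.map (I * J).mkQ) ha
    rw [Submodule.map_sup, Submodule.mkQ_map_self, bot_sup_eq, Ideal.span, Submodule.map_span,
      Set.image_singleton] at h
    rw [LinearMap.range_toSpanSingleton, h]
  have hker : LinearMap.ker f = J := by
    ext r
    have : r ∈ LinearMap.ker f ↔ r * a ∈ I * J := by
      rw [LinearMap.mem_ker, ← Submodule.Quotient.mk_eq_zero]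
      rfl
    rw [this]
    constructor
    · intro h
      rw [← Ideal.span_singleton_le_iff_mem, ← Ideal.dvd_iff_le,
        ← Ideal.span_singleton_mul_span_singleton, hA, mul_left_comm,
        mul_dvd_mul_iff_left hI] at h
      rw [← Ideal.span_singleton_le_iff_mem, ← Ideal.dvd_iff_le]
      exact (Ideal.isCoprime_iff_sup_eq.2 hco).dvd_of_dvd_mul_right h
    · intro h
      rw [mul_comm r]
      exact Ideal.mul_mem_mul haI h
  rw [← hrange, ← Nat.card_congr f.quotKerEquivRange.toEquiv, hker]

lemma codim_pow {I : Ideal R} (hI : I ≠ ⊥) (k : ℕ) : (I ^ k).codim F = k * I.codim F := by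
  induction k with
  | zero => rw [pow_zero, Ideal.one_eq_top, codim_top, zero_mul]
  | succ k ih => rw [pow_succ, codim_mul F (pow_ne_zero k hI) hI, ih]; ring

lemma codim_prod (s : Multiset (Ideal R)) (hs : ∀ P ∈ s, P ≠ ⊥) :
    s.prod.codim F = (s.map (Ideal.codim F)).sum := by
  induction s using Multiset.induction with
  | empty => simp [codim_top]
  | cons a s ih =>
    have h1 : ∀ P ∈ s, P ≠ ⊥ := fun P hP => hs P (Multiset.mem_cons_of_mem hP)
    rw [Multiset.prod_cons, Multiset.map_cons, Multiset.sum_cons, codim_mul F, ih h1]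
    · exact hs a (Multiset.mem_cons_self _ _)
    · exact Multiset.prod_ne_zero fun h => h1 0 h rfl

lemma codim_le_of_dvd {I J : Ideal R} (hJ : J ≠ ⊥) (h : I ∣ J) : I.codim F ≤ J.codim F := by
  obtain ⟨A, rfl⟩ := h
  rw [codim_mul F (left_ne_zero_of_mul hJ) (right_ne_zero_of_mul hJ)]
  omega

open scoped Classical in
/-- The codimension of an ideal is the sum of the degrees of its prime power divisors: a prime
power `P ^ k` counts with weight the degree of `P`. -/
lemma codim_eq_sum_prime_pow {I : Ideal R} (hI : I ≠ ⊥) {m : ℕ} (hm : I.codim F = m)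
    (S : Finset (Ideal R)) (hS : ∀ P, P ∈ S ↔ (P.IsPrime ∧ P ≠ ⊥) ∧ P.codim F ≤ m) :
    m = ∑ P ∈ S, ∑ k ∈ Finset.Icc 1 m, if P ^ k ∣ I then P.codim F else 0 := by
  have hfac : ∀ P ∈ normalizedFactors I, P ≠ ⊥ := fun P hP => (prime_of_normalized_factor P hP).1
  have h1 : m = ((normalizedFactors I).map (Ideal.codim F)).sum := by
    rw [← codim_prod F _ hfac, ← hm]
    rw [Ideal.prod_normalizedFactors_eq_self hI]
  have hsub : (normalizedFactors I).toFinset ⊆ S := by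
    intro P hP
    rw [Multiset.mem_toFinset] at hP
    exact (hS P).2 ⟨⟨Ideal.isPrime_of_prime (prime_of_normalized_factor P hP), hfac P hP⟩,
      hm ▸ codim_le_of_dvd F hI (dvd_of_mem_normalizedFactors hP)⟩
  rw [Finset.sum_multiset_map_count, Finset.sum_subset hsub] at h1
  · nth_rewrite 1 [h1]
    refine Finset.sum_congr rfl fun P hP => ?_
    obtain ⟨⟨hpr, hP0⟩, -⟩ := (hS P).1 hP
    have hprime : Prime P := Ideal.prime_of_isPrime hP0 hpr
    have key : ∀ k, P ^ k ∣ I ↔ k ≤ (normalizedFactors I).count P := by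
      intro k
      rw [pow_dvd_iff_le_emultiplicity, emultiplicity_eq_count_normalizedFactors
        hprime.irreducible hI, normalize_eq, Nat.cast_le]
    have hle : (normalizedFactors I).count P ≤ m := by
      have := codim_le_of_dvd F hI ((key _).2 le_rfl)
      rw [codim_pow F hP0, hm] at this
      exact (Nat.le_mul_of_pos_right _ (codim_pos hP0 hpr.ne_top)).trans this
    rw [← Finset.sum_filter, Finset.sum_const, smul_eq_mul, smul_eq_mul]
    congr 1
    have : (Finset.Icc 1 m).filter (fun k => P ^ k ∣ I)
        = Finset.Icc 1 ((normalizedFactors I).count P) := by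
      ext k
      simp only [Finset.mem_filter, Finset.mem_Icc, key]
      omega
    rw [this, Nat.card_Icc]
    omega
  · intro P _ hP
    rw [Multiset.mem_toFinset] at hP
    rw [Multiset.count_eq_zero.2 hP, zero_smul]

/-- Ideals divisible by `J` correspond to ideals by division by `J`. -/
lemma card_codim_eq_dvd {J : Ideal R} (hJ : J ≠ ⊥) (n : ℕ) :
    Nat.card {I : Ideal R // (I ≠ ⊥ ∧ I.codim F = J.codim F + n) ∧ J ∣ I} = idealCount F R n := by
  refine (Nat.card_congr (Equiv.ofBijective
    (fun A : {A : Ideal R // A ≠ ⊥ ∧ A.codim F = n} => ⟨J * A.1, ⟨mul_ne_zero hJ A.2.1,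
      by rw [codim_mul F hJ A.2.1, A.2.2]⟩, dvd_mul_right _ _⟩) ⟨?_, ?_⟩)).symm
  · intro A B h
    exact Subtype.ext (mul_left_cancel₀ hJ (congrArg Subtype.val h))
  · rintro ⟨I, ⟨hI, hc⟩, A, rfl⟩
    have hA := right_ne_zero_of_mul hI
    rw [codim_mul F hJ hA] at hc
    exact ⟨⟨A, hA, by omega⟩, rfl⟩

variable (R) in
/-- The logarithmic derivative of the Euler product of the zeta function `∑ T ^ codim I`. -/
theorem mul_idealCount (m : ℕ) :
    m * idealCount F R m = ∑ r ∈ Finset.Icc 1 m,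
      (∑ d ∈ r.divisors, d * primeCount F R d) * idealCount F R (m - r) := by
  classical
  have hfinI := finite_codim_eq F R m
  have hfinP : {P : Ideal R | (P.IsPrime ∧ P ≠ ⊥) ∧ P.codim F ≤ m}.Finite := by
    refine ((Set.finite_Iic m).biUnion fun d _ => finite_codim_eq F R d).subset ?_
    rintro P ⟨⟨_, h0⟩, hd⟩
    exact Set.mem_biUnion (Set.mem_Iic.2 hd) ⟨h0, rfl⟩
  set T := hfinI.toFinset with hT
  set S := hfinP.toFinset with hS
  have hTcard : idealCount F R m = T.card := by
    exact Nat.subtype_card _ fun I => hfinI.mem_toFinset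
  have hcount : ∀ P ∈ S, ∀ k ∈ Finset.Icc 1 m, (T.filter (fun I => P ^ k ∣ I)).card
      = if k * P.codim F ≤ m then idealCount F R (m - k * P.codim F) else 0 := by
    intro P hP k _
    obtain ⟨⟨hpr, hP0⟩, -⟩ := hfinP.mem_toFinset.1 hP
    have hc := codim_pow F hP0 k
    split_ifs with h
    · rw [← card_codim_eq_dvd F (pow_ne_zero k hP0 : P ^ k ≠ ⊥), hc, Nat.add_sub_cancel' h]
      refine (Nat.subtype_card _ fun I => ?_).symm
      rw [Finset.mem_filter, hT, hfinI.mem_toFinset]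
      rfl
    · rw [Finset.card_eq_zero, Finset.filter_eq_empty_iff]
      intro I hI hd
      obtain ⟨hI0, hIm⟩ := hfinI.mem_toFinset.1 hI
      have := codim_le_of_dvd F hI0 hd
      omega
  have hprime : ∀ d ∈ Finset.Icc 1 m, (S.filter (fun P => P.codim F = d)).card
      = primeCount F R d := by
    intro d hd
    refine (Nat.subtype_card _ fun P => ?_).symm
    rw [Finset.mem_filter, hS, hfinP.mem_toFinset]
    have := (Finset.mem_Icc.1 hd).2
    exact ⟨fun h => ⟨h.1.1, h.2⟩, fun h => ⟨⟨h.1, h.2.trans_le this⟩, h.2⟩⟩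
  calc m * idealCount F R m = ∑ I ∈ T, m := by rw [Finset.sum_const, hTcard, smul_eq_mul, mul_comm]
    _ = ∑ I ∈ T, ∑ P ∈ S, ∑ k ∈ Finset.Icc 1 m, if P ^ k ∣ I then P.codim F else 0 := by
        refine Finset.sum_congr rfl fun I hI => ?_
        obtain ⟨hI0, hIm⟩ := hfinI.mem_toFinset.1 hI
        exact codim_eq_sum_prime_pow F hI0 hIm S fun P => hfinP.mem_toFinset
    _ = ∑ P ∈ S, ∑ k ∈ Finset.Icc 1 m, P.codim F *
          if k * P.codim F ≤ m then idealCount F R (m - k * P.codim F) else 0 := by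
        rw [Finset.sum_comm]
        refine Finset.sum_congr rfl fun P hP => ?_
        rw [Finset.sum_comm]
        refine Finset.sum_congr rfl fun k hk => ?_
        rw [← hcount P hP k hk, ← Finset.sum_filter, Finset.sum_const, smul_eq_mul, mul_comm]
    _ = ∑ d ∈ Finset.Icc 1 m, ∑ k ∈ Finset.Icc 1 m, primeCount F R d * (d *
          if k * d ≤ m then idealCount F R (m - k * d) else 0) := by
        have hmaps : ∀ P ∈ S, P.codim F ∈ Finset.Icc 1 m := by
          intro P hP
          obtain ⟨⟨hpr, hP0⟩, hle⟩ := hfinP.mem_toFinset.1 hP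
          exact Finset.mem_Icc.2 ⟨codim_pos hP0 hpr.ne_top, hle⟩
        rw [← Finset.sum_fiberwise_of_maps_to hmaps]
        refine Finset.sum_congr rfl fun d hd => ?_
        rw [← Finset.mul_sum, ← hprime d hd, ← smul_eq_mul, ← Finset.sum_const]
        refine Finset.sum_congr rfl fun P hP => ?_
        rw [(Finset.mem_filter.1 hP).2]
    _ = _ := by
        simp_rw [Finset.sum_mul]
        rw [Finset.sum_sigma', Finset.sum_sigma', ← Finset.sum_filter_of_ne
          (p := fun x => x.2 * x.1 ≤ m)]
        · refine Finset.sum_nbij' (fun x => ⟨x.2 * x.1, x.1⟩) (fun y => ⟨y.2, y.1 / y.2⟩)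
            ?_ ?_ ?_ ?_ ?_
          · rintro ⟨d, k⟩ h
            simp only [Finset.mem_filter, Finset.mem_sigma, Finset.mem_Icc] at h
            obtain ⟨⟨⟨h1, h2⟩, h3, h4⟩, h5⟩ := h
            simp only [Finset.mem_sigma, Finset.mem_Icc, Nat.mem_divisors]
            exact ⟨⟨Nat.mul_pos h3 h1, h5⟩, dvd_mul_left _ _, (Nat.mul_pos h3 h1).ne'⟩
          · rintro ⟨r, d⟩ h
            simp only [Finset.mem_sigma, Finset.mem_Icc, Nat.mem_divisors] at h
            obtain ⟨⟨h1, h2⟩, ⟨k, rfl⟩, h3⟩ := h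
            have hd : 0 < d := Nat.pos_of_mul_pos_right h1
            have hk : 0 < k := Nat.pos_of_mul_pos_left h1
            simp only [Finset.mem_filter, Finset.mem_sigma, Finset.mem_Icc,
              Nat.mul_div_cancel_left _ hd]
            refine ⟨⟨⟨hd, ?_⟩, hk, ?_⟩, ?_⟩ <;> nlinarith
          · rintro ⟨d, k⟩ h
            simp only [Finset.mem_filter, Finset.mem_sigma, Finset.mem_Icc] at h
            simp [Nat.mul_div_cancel _ h.1.1.1]
          · rintro ⟨r, d⟩ h
            simp only [Finset.mem_sigma, Finset.mem_Icc, Nat.mem_divisors] at h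
            simp [Nat.div_mul_cancel h.2.1]
          · rintro ⟨d, k⟩ h
            rw [if_pos (Finset.mem_filter.1 h).2]
            ring
        · rintro ⟨d, k⟩ _ h
          by_contra hc
          exact h (by simp [hc])

omit [Finite F] [IsDedekindDomain R] in
/-- A homomorphism to a finite extension `K` of `F` is a nonzero prime `P`, its kernel, together
with an embedding of `R / P` in `K`. -/
theorem card_algHom_eq_sum_divisors [Infinite R] (K : Type*) [Field K] [Algebra F K] [Finite K] :
    Nat.card (R →ₐ[F] K) = ∑ d ∈ (finrank F K).divisors, d * primeCount F R d := by
  classical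
  have hK : 0 < finrank F K := finrank_pos
  let Pr := {P : Ideal R // (P.IsPrime ∧ P ≠ ⊥) ∧ P.codim F ∣ finrank F K}
  have hfin : {P : Ideal R | (P.IsPrime ∧ P ≠ ⊥) ∧ P.codim F ∣ finrank F K}.Finite := by
    refine ((Set.finite_Iic (finrank F K)).biUnion fun d _ => finite_codim_eq F R d).subset ?_
    rintro P ⟨⟨_, h0⟩, hd⟩
    exact Set.mem_biUnion (Set.mem_Iic.2 (Nat.le_of_dvd hK hd)) ⟨h0, rfl⟩
  have : Finite Pr := hfin
  have := Fintype.ofFinite Pr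
  have hker : ∀ f : R →ₐ[F] K, ((RingHom.ker f).IsPrime ∧ RingHom.ker f ≠ ⊥) ∧
      (RingHom.ker f).codim F ∣ finrank F K := by
    intro f
    have hpr : (RingHom.ker f).IsPrime := RingHom.ker_isPrime f
    have h0 : RingHom.ker f ≠ ⊥ := fun h =>
      not_injective_infinite_finite f ((RingHom.injective_iff_ker_eq_bot f).2 h)
    refine ⟨⟨hpr, h0⟩, ?_⟩
    have hmax := Ring.HasFiniteQuotients.maximalOfPrime h0
    let := Ideal.Quotient.field (RingHom.ker f)
    exact FiniteField.nonempty_algHom_iff_finrank_dvd.1 ⟨Ideal.kerLiftAlg f⟩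
  let e : (Σ P : Pr, (R ⧸ P.1) →ₐ[F] K) ≃ (R →ₐ[F] K) :=
    Equiv.ofBijective (fun g => g.2.comp (Ideal.Quotient.mkₐ F g.1.1)) <| by
      have hk : ∀ (P : Pr) (g : (R ⧸ P.1) →ₐ[F] K),
          RingHom.ker (g.comp (Ideal.Quotient.mkₐ F P.1)) = P.1 := by
        rintro ⟨P, ⟨hpr, h0⟩, hd⟩ g
        have hmax := Ring.HasFiniteQuotients.maximalOfPrime h0
        let := Ideal.Quotient.field P
        ext x
        rw [RingHom.mem_ker, AlgHom.comp_apply,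
          map_eq_zero_iff g (RingHom.injective g.toRingHom)]
        exact Ideal.Quotient.eq_zero_iff_mem
      refine ⟨?_, fun f => ⟨⟨⟨RingHom.ker f, hker f⟩, Ideal.kerLiftAlg f⟩, by ext; rfl⟩⟩
      rintro ⟨P, g⟩ ⟨Q, h⟩ hgh
      obtain rfl : P = Q := Subtype.ext (by
        rw [← hk P g, ← hk Q h]
        exact congrArg (fun f : R →ₐ[F] K => RingHom.ker f) hgh)
      congr 1
      exact Ideal.Quotient.algHom_ext _ hgh
  have hfib : ∀ P : Pr, Nat.card ((R ⧸ P.1) →ₐ[F] K) = P.1.codim F := by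
    rintro ⟨P, ⟨hpr, h0⟩, hd⟩
    have hmax := Ring.HasFiniteQuotients.maximalOfPrime h0
    let := Ideal.Quotient.field P
    exact FiniteField.natCard_algHom_of_finrank_dvd hd
  have : ∀ P : Pr, Finite ((R ⧸ P.1) →ₐ[F] K) := fun P =>
    have := Ring.HasFiniteQuotients.finiteQuotient P.2.1.2
    inferInstance
  rw [Nat.card_congr e.symm, Nat.card_sigma]
  simp_rw [hfib]
  rw [← Finset.sum_fiberwise_of_maps_to (s := Finset.univ) (t := (finrank F K).divisors)
    (g := fun P : Pr => P.1.codim F) fun P _ => Nat.mem_divisors.2 ⟨P.2.2, hK.ne'⟩]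
  refine Finset.sum_congr rfl fun d hd => ?_
  rw [Finset.sum_congr rfl (fun P hP => (Finset.mem_filter.1 hP).2), Finset.sum_const, smul_eq_mul,
    mul_comm]
  congr 1
  rw [← Nat.subtype_card (p := fun P : Pr => P.1.codim F = d) _ (by simp)]
  refine Nat.card_congr ((Equiv.subtypeSubtypeEquivSubtypeInter _
    (fun P : Ideal R => P.codim F = d)).trans (Equiv.subtypeEquivRight fun P => ?_))
  exact ⟨fun h => ⟨h.1.1, h.2⟩, fun h => ⟨⟨h.1, h.2 ▸ Nat.dvd_of_mem_divisors hd⟩, h.2⟩⟩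

end DedekindAlgebra

/-! ### The coordinate ring of an elliptic curve is a Dedekind domain -/

namespace WeierstrassCurve.Affine.CoordinateRing

open Polynomial Module
open scoped Polynomial.Bivariate

variable {F : Type*} [Field F] {W : WeierstrassCurve.Affine F}

/-- A root `x` of multiplicity two of the norm of `p + q Y` at which the trace of `p + q Y`
vanishes is a root of `q`: otherwise the curve is singular at the point `(x, -p(x) / q(x))`. -/
lemma aeval_eq_zero_of_trace_of_norm [W.IsElliptic] {K : Type*} [Field K] [Algebra F K] (x : K)
    (p q : F[X]) (hT : aeval x (2 * p - q * (C W.a₁ * X + C W.a₃)) = 0)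
    (hN : aeval x (p ^ 2 - p * q * (C W.a₁ * X + C W.a₃) -
      q ^ 2 * (X ^ 3 + C W.a₂ * X ^ 2 + C W.a₄ * X + C W.a₆)) = 0)
    (hder : aeval x (derivative (p ^ 2 - p * q * (C W.a₁ * X + C W.a₃) -
      q ^ 2 * (X ^ 3 + C W.a₂ * X ^ 2 + C W.a₄ * X + C W.a₆))) = 0) :
    aeval x q = 0 := by
  by_contra hq0
  simp only [map_sub, map_add, map_mul, map_pow, aeval_X, aeval_C, derivative_mul,
    derivative_pow, derivative_X, derivative_C, map_ofNat, map_natCast] at hder hN hT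
  generalize aeval x (derivative p) = P' at *
  generalize aeval x (derivative q) = Q' at *
  generalize aeval x q = Q at *
  obtain ⟨y, hP⟩ : ∃ y, aeval x p = -(y * Q) := ⟨-aeval x p / Q, by field_simp⟩
  rw [hP] at hT hN hder
  have heq : (W.map (algebraMap F K)).toAffine.Equation x y := by
    rw [equation_iff']
    simp only [map_a₁, map_a₂, map_a₃, map_a₄, map_a₆]
    refine (mul_eq_zero.1 ?_).resolve_left (pow_ne_zero 2 hq0)
    linear_combination hN
  have hns := equation_iff_nonsingular.1 heq
  rw [nonsingular_iff'] at hns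
  simp only [map_a₁, map_a₂, map_a₃, map_a₄] at hns
  refine hns.2.elim (fun h => h ?_) (fun h => h ?_)
  · refine (mul_eq_zero.1 ?_).resolve_left (pow_ne_zero 3 hq0)
    simp only [map_one, map_zero, Nat.cast_ofNat] at hder
    linear_combination Q * hder + (-Q * P' - Q' * y * Q) * hT - 2 * Q' * hN
  · refine (mul_eq_zero.1 ?_).resolve_left hq0
    linear_combination -hT

lemma dvd_of_dvd_trace_of_sq_dvd_norm [W.IsElliptic] {π p q : F[X]} (hπ : Irreducible π)
    (htr : π ∣ 2 * p - q * (C W.a₁ * X + C W.a₃))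
    (hnorm : π ^ 2 ∣ p ^ 2 - p * q * (C W.a₁ * X + C W.a₃) -
      q ^ 2 * (X ^ 3 + C W.a₂ * X ^ 2 + C W.a₄ * X + C W.a₆)) : π ∣ q := by
  have := Fact.mk hπ
  have hz : ∀ g : F[X], aeval (AdjoinRoot.root π) g = 0 ↔ π ∣ g := fun g => by
    rw [AdjoinRoot.aeval_eq, AdjoinRoot.mk_eq_zero]
  have h := pow_sub_one_dvd_derivative_of_pow_dvd hnorm
  rw [pow_one] at h
  exact (hz q).1 (aeval_eq_zero_of_trace_of_norm _ p q ((hz _).2 htr)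
    ((hz _).2 ((dvd_pow_self π two_ne_zero).trans hnorm)) ((hz _).2 h))

lemma mk_Y_sq : mk W Y ^ 2 + algebraMap F[X] W.CoordinateRing (C W.a₁ * X + C W.a₃) * mk W Y =
    algebraMap F[X] W.CoordinateRing (X ^ 3 + C W.a₂ * X ^ 2 + C W.a₄ * X + C W.a₆) := by
  have h : mk W (Y ^ 2 + C (C W.a₁ * X + C W.a₃) * Y -
    C (X ^ 3 + C W.a₂ * X ^ 2 + C W.a₄ * X + C W.a₆)) = 0 := AdjoinRoot.mk_self
  rw [map_sub, map_add, map_mul, map_pow, sub_eq_zero] at h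
  exact h

/-- Every element of the coordinate ring divides its norm. -/
lemma dvd_algebraMap_norm (z : W.CoordinateRing) :
    z ∣ algebraMap F[X] W.CoordinateRing (Algebra.norm F[X] z) := by
  obtain ⟨p, q, rfl⟩ := exists_smul_basis_eq z
  have := coe_norm_smul_basis (W' := W) p q
  refine ⟨mk W (C p + C q * (-(Y : F[X][Y]) - C (C W.a₁ * X + C W.a₃))), ?_⟩
  refine this.trans ?_
  rw [map_mul]
  congr 1
  simp [smul]

/-- Let `π` be irreducible in `F[X]`. If `w = z / π` is integral over `F[X]`, then `π` divides `z`.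
-/
lemma exists_algebraMap_eq_of_isIntegral_div [W.IsElliptic] {π : F[X]} (hπ : Irreducible π)
    {w : W.FunctionField} (hw : _root_.IsIntegral F[X] w) {z : W.CoordinateRing}
    (hz : algebraMap F[X] W.FunctionField π * w = algebraMap W.CoordinateRing W.FunctionField z) :
    ∃ y, algebraMap W.CoordinateRing W.FunctionField y = w := by
  obtain ⟨p, q, rfl⟩ := exists_smul_basis_eq z
  set l := C W.a₁ * X + C W.a₃ with hl
  set f := X ^ 3 + C W.a₂ * X ^ 2 + C W.a₄ * X + C W.a₆ with hf
  set i := algebraMap F[X] W.FunctionField with hi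
  have hinj : Function.Injective i := FaithfulSMul.algebraMap_injective _ _
  have hi0 : i π ≠ 0 := (map_ne_zero_iff i hinj).2 hπ.ne_zero
  set η := algebraMap W.CoordinateRing W.FunctionField (mk W Y) with hη
  have hz' : i π * w = i p + i q * η := by
    rw [hz, map_add, ← algebraMap_smul W.CoordinateRing p, ← algebraMap_smul W.CoordinateRing q,
      smul_eq_mul, smul_eq_mul, mul_one, map_mul, ← IsScalarTower.algebraMap_apply,
      ← IsScalarTower.algebraMap_apply]
  have hηsq : η ^ 2 + i l * η = i f := by
    have h := congrArg (algebraMap W.CoordinateRing W.FunctionField) (mk_Y_sq (W := W))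
    rwa [map_add, map_mul, map_pow, ← IsScalarTower.algebraMap_apply,
      ← IsScalarTower.algebraMap_apply] at h
  -- `π w` is a root of a quadratic polynomial given by the trace and the norm of `p + q Y`
  let P : F[X][X] := C (π ^ 2) * X ^ 2 + C (-(π * (2 * p - q * l))) * X
    + C (p ^ 2 - p * q * l - q ^ 2 * f)
  have hP0 : aeval w P = 0 := by
    simp only [P, map_add, map_mul, map_pow, aeval_X, aeval_C, map_sub, map_neg, map_ofNat]
    linear_combination (i π * w + i p + i q * η - 2 * i p + i q * i l) * hz' + i q ^ 2 * hηsq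
  have hcoeff : P.coeff 0 = p ^ 2 - p * q * l - q ^ 2 * f ∧
      P.coeff 1 = -(π * (2 * p - q * l)) ∧ P.coeff 2 = π ^ 2 := by
    have : ∀ a b c : F[X], (C a * X ^ 2 + C b * X + C c).coeff 0 = c ∧
        (C a * X ^ 2 + C b * X + C c).coeff 1 = b ∧ (C a * X ^ 2 + C b * X + C c).coeff 2 = a :=
      fun a b c => by simp [coeff_X, coeff_C]
    exact this _ _ _
  have hdvd := minpoly.isIntegrallyClosed_dvd hw hP0
  have hmonic := minpoly.monic hw
  have hπ2 : π ^ 2 ≠ 0 := pow_ne_zero 2 hπ.ne_zero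
  have hdegP : P.natDegree = 2 := natDegree_quadratic hπ2
  have hPne : P ≠ 0 := fun h => by simp [h] at hdegP
  obtain ⟨c, hc⟩ := hdvd
  have hcne : c ≠ 0 := fun h => hPne (by rw [hc, h, mul_zero])
  have hdeg : (minpoly F[X] w).natDegree + c.natDegree = 2 := by
    rw [← hdegP, hc, hmonic.natDegree_mul' hcne]
  have hpos := minpoly.natDegree_pos hw
  obtain h1 | h1 : (minpoly F[X] w).natDegree = 1 ∨ (minpoly F[X] w).natDegree = 2 := by omega
  · have h := minpoly.aeval F[X] w
    rw [hmonic.eq_X_add_C h1, map_add, aeval_X, aeval_C] at h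
    refine ⟨algebraMap F[X] _ (-(minpoly F[X] w).coeff 0), ?_⟩
    rw [← IsScalarTower.algebraMap_apply, map_neg]
    linear_combination -h
  -- here the minimal polynomial of `w` is `P / π ^ 2`, so `π ^ 2` divides the coefficients of `P`
  · obtain ⟨c, rfl⟩ : ∃ a, c = C a := ⟨_, eq_C_of_natDegree_eq_zero (by omega)⟩
    have hco : ∀ n, P.coeff n = (minpoly F[X] w).coeff n * c := fun n => by rw [hc, coeff_mul_C]
    have hcπ : c = π ^ 2 := by
      have := hco 2
      rw [← h1, hmonic.coeff_natDegree, one_mul, h1] at this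
      rw [← this, hcoeff.2.2]
    have hnorm : π ^ 2 ∣ p ^ 2 - p * q * l - q ^ 2 * f := by
      have := hco 0
      rw [hcπ] at this
      refine ⟨(minpoly F[X] w).coeff 0, ?_⟩
      rw [mul_comm (π ^ 2), ← this, hcoeff.1]
    have htr : π ∣ 2 * p - q * l := by
      have := hco 1
      rw [hcπ] at this
      refine ⟨-(minpoly F[X] w).coeff 1, ?_⟩
      apply mul_left_cancel₀ hπ.ne_zero
      rw [hcoeff.2.1] at this
      linear_combination -this
    have hq := dvd_of_dvd_trace_of_sq_dvd_norm hπ htr hnorm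
    have hp : π ∣ p := by
      refine hπ.prime.dvd_of_dvd_pow (n := 2) ?_
      have := ((dvd_pow_self π two_ne_zero).trans hnorm).add
        (dvd_mul_of_dvd_left hq (p * l + q * f))
      convert this using 1
      ring
    obtain ⟨p', rfl⟩ := hp
    obtain ⟨q', rfl⟩ := hq
    refine ⟨algebraMap F[X] _ p' + algebraMap F[X] _ q' * mk W Y, ?_⟩
    rw [map_add, map_mul, ← IsScalarTower.algebraMap_apply, ← IsScalarTower.algebraMap_apply]
    apply mul_left_cancel₀ hi0
    rw [hz', map_mul, map_mul]
    ring

/-- An integral fraction has, after multiplication by a norm, a denominator `d` in `F[X]`, whose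
irreducible factors can be removed one by one. -/
lemma isIntegrallyClosed [W.IsElliptic] : IsIntegrallyClosed W.CoordinateRing := by
  have hfin : Module.Finite F[X] W.CoordinateRing := Module.Finite.of_basis (CoordinateRing.basis W)
  rw [isIntegrallyClosed_iff W.FunctionField]
  intro w hw
  have hw' : _root_.IsIntegral F[X] w := isIntegral_trans w hw
  suffices ∀ d : F[X], d ≠ 0 → ∀ w : W.FunctionField, _root_.IsIntegral F[X] w → ∀ z,
      algebraMap F[X] W.FunctionField d * w = algebraMap W.CoordinateRing W.FunctionField z →
      ∃ y, algebraMap W.CoordinateRing W.FunctionField y = w by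
    obtain ⟨r, s, hs, rfl⟩ := IsFractionRing.div_surjective (A := W.CoordinateRing) w
    have hs0 : s ≠ 0 := nonZeroDivisors.ne_zero hs
    obtain ⟨t, ht⟩ := dvd_algebraMap_norm s
    refine this (Algebra.norm F[X] s) ?_ _ hw' (t * r) ?_
    · exact (Algebra.norm_ne_zero_iff_of_basis (CoordinateRing.basis W)).2 hs0
    · have : algebraMap W.CoordinateRing W.FunctionField s ≠ 0 := by simpa using hs0
      rw [IsScalarTower.algebraMap_apply F[X] W.CoordinateRing, ht, map_mul, map_mul]
      field_simp
  intro d hd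
  induction d using WfDvdMonoid.induction_on_irreducible with
  | zero => exact absurd rfl hd
  | unit d hu =>
    intro w hw z hz
    obtain ⟨e, he⟩ := hu.exists_left_inv
    refine ⟨algebraMap F[X] _ e * z, ?_⟩
    rw [map_mul, ← hz, ← IsScalarTower.algebraMap_apply, ← mul_assoc, ← map_mul, he, map_one,
      one_mul]
  | mul d π hd0 hπ ih =>
    intro w hw z hz
    have h1 : _root_.IsIntegral F[X] (algebraMap F[X] W.FunctionField d * w) :=
      isIntegral_algebraMap.mul hw
    obtain ⟨y, hy⟩ := exists_algebraMap_eq_of_isIntegral_div hπ h1 (z := z)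
      (by rw [← hz, map_mul, mul_assoc])
    exact ih hd0 w hw y hy.symm

end WeierstrassCurve.Affine.CoordinateRing

/-! ### The degree of a function and the Riemann–Roch spaces of the point at infinity -/

namespace WeierstrassCurve.Affine.CoordinateRing

open Polynomial Module
open scoped Polynomial.Bivariate

section Degree

variable {F : Type*} [Field F] {W : WeierstrassCurve.Affine F}

/-- The degree of a nonzero `z` in the coordinate ring, i.e. the order of its pole at infinity. It
is read off from the norm to `F[X]`; `X` has degree `2` and `Y` has degree `3`. The degree of `0` is
`0`. -/
noncomputable def deg (z : W.CoordinateRing) : ℕ := (Algebra.norm F[X] z).natDegree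

instance : Module.Finite F[X] W.CoordinateRing := Module.Finite.of_basis (CoordinateRing.basis W)

lemma norm_ne_zero {z : W.CoordinateRing} (hz : z ≠ 0) : Algebra.norm F[X] z ≠ 0 :=
  (Algebra.norm_ne_zero_iff_of_basis (CoordinateRing.basis W)).2 hz

lemma deg_mul {y z : W.CoordinateRing} (hy : y ≠ 0) (hz : z ≠ 0) : deg (y * z) = deg y + deg z := by
  rw [deg, map_mul, natDegree_mul (norm_ne_zero hy) (norm_ne_zero hz), deg, deg]

lemma deg_pow {z : W.CoordinateRing} (n : ℕ) : deg (z ^ n) = n * deg z := by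
  rw [deg, map_pow, natDegree_pow, deg]

@[simp] lemma deg_zero : deg (0 : W.CoordinateRing) = 0 := by
  rw [deg, Algebra.norm_zero, natDegree_zero]

lemma codim_span {z : W.CoordinateRing} (hz : z ≠ 0) : (Ideal.span {z}).codim F = deg z :=
  finrank_quotient_span_eq_natDegree_norm (CoordinateRing.basis W) hz

variable (W) in
/-- The pairs `(p, q)` of polynomials are the functions `p + q Y`. -/
noncomputable def pairEquiv : (F[X] × F[X]) ≃ₗ[F] W.CoordinateRing :=
  LinearEquiv.ofBijective
    { toFun := fun a => a.1 • (1 : W.CoordinateRing) + a.2 • mk W Y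
      map_add' := fun a b => by simp only [Prod.fst_add, Prod.snd_add, add_smul]; abel
      map_smul' := fun c a => by simp [smul_assoc] }
    ⟨by
      refine (injective_iff_map_eq_zero _).2 fun a ha => ?_
      obtain ⟨h1, h2⟩ := smul_basis_eq_zero ha
      exact Prod.ext h1 h2, fun z => by
      obtain ⟨p, q, rfl⟩ := exists_smul_basis_eq z
      exact ⟨(p, q), rfl⟩⟩

lemma pairEquiv_apply (a : F[X] × F[X]) :
    pairEquiv W a = a.1 • (1 : W.CoordinateRing) + a.2 • mk W Y := rfl

lemma deg_pairEquiv_le_iff (a : F[X] × F[X]) (k : ℕ) :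
    deg (pairEquiv W a) ≤ k ↔ a ∈ (degreeLT F (k / 2 + 1)).prod (degreeLT F ((k - 1) / 2)) := by
  rw [deg, natDegree_le_iff_degree_le, pairEquiv_apply, degree_norm_smul_basis, max_le_iff,
    Submodule.mem_prod, mem_degreeLT, mem_degreeLT]
  refine and_congr ?_ ?_
  · rcases eq_or_ne a.1 0 with h | h
    · simp [h]
    · rw [degree_eq_natDegree h]
      rw [two_nsmul]
      norm_cast
      omega
  · rcases eq_or_ne a.2 0 with h | h
    · simp [h]
    · rw [degree_eq_natDegree h]
      rw [two_nsmul]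
      norm_cast
      omega

variable (W) in
/-- The functions of degree at most `k`, i.e. the Riemann–Roch space of `k` times the point at
infinity. -/
noncomputable def functionsOfDegLE (k : ℕ) : Submodule F W.CoordinateRing :=
  LinearMap.range ((pairEquiv W).toLinearMap ∘ₗ
    (degreeLT F (k / 2 + 1)).subtype.prodMap (degreeLT F ((k - 1) / 2)).subtype)

lemma mem_functionsOfDegLE {k : ℕ} {z : W.CoordinateRing} :
    z ∈ functionsOfDegLE W k ↔ deg z ≤ k := by
  obtain ⟨a, rfl⟩ := (pairEquiv W).surjective z
  rw [deg_pairEquiv_le_iff, functionsOfDegLE]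
  refine ⟨?_, fun h => ⟨⟨⟨a.1, h.1⟩, ⟨a.2, h.2⟩⟩, rfl⟩⟩
  rintro ⟨b, hb⟩
  obtain rfl := (pairEquiv W).injective hb
  exact ⟨b.1.2, b.2.2⟩

lemma deg_add_le {y z : W.CoordinateRing} {k : ℕ} (hy : deg y ≤ k) (hz : deg z ≤ k) :
    deg (y + z) ≤ k :=
  mem_functionsOfDegLE.1 (add_mem (mem_functionsOfDegLE.2 hy) (mem_functionsOfDegLE.2 hz))

/-- Coordinates on the functions of degree at most `k`. -/
noncomputable def functionsOfDegLEEquiv (k : ℕ) : functionsOfDegLE W k ≃ₗ[F]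
    (Fin (k / 2 + 1) → F) × (Fin ((k - 1) / 2) → F) :=
  (LinearEquiv.ofInjective ((pairEquiv W).toLinearMap ∘ₗ (degreeLT F _).subtype.prodMap
    (degreeLT F _).subtype) ((pairEquiv W).injective.comp
    (Subtype.val_injective.prodMap Subtype.val_injective))).symm ≪≫ₗ
    (degreeLTEquiv F _).prodCongr (degreeLTEquiv F _)

instance (k : ℕ) : Module.Finite F (functionsOfDegLE W k) :=
  .equiv (functionsOfDegLEEquiv k).symm

lemma finrank_functionsOfDegLE {k : ℕ} (hk : k ≠ 0) : finrank F (functionsOfDegLE W k) = k := by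
  rw [(functionsOfDegLEEquiv k).finrank_eq, finrank_prod, finrank_fin_fun, finrank_fin_fun]
  omega

lemma pairEquiv_C (c : F) : pairEquiv W (C c, 0) = algebraMap F W.CoordinateRing c := by
  rw [pairEquiv_apply, zero_smul, add_zero, ← algebraMap_eq, algebraMap_smul, Algebra.smul_def,
    mul_one]

lemma deg_algebraMap (c : F) : deg (algebraMap F W.CoordinateRing c) = 0 := by
  rw [← Nat.le_zero, ← pairEquiv_C, deg_pairEquiv_le_iff, Submodule.mem_prod, mem_degreeLT,
    mem_degreeLT]
  exact ⟨degree_C_lt, by simp⟩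

lemma exists_algebraMap_eq_of_deg_le_one {z : W.CoordinateRing} (hz : deg z ≤ 1) :
    ∃ c, algebraMap F W.CoordinateRing c = z := by
  obtain ⟨⟨p, q⟩, rfl⟩ := (pairEquiv W).surjective z
  rw [deg_pairEquiv_le_iff, Submodule.mem_prod, mem_degreeLT, mem_degreeLT] at hz
  obtain ⟨h1, h2⟩ := hz
  have hq : q = 0 := by simpa using h2
  have hp : p = C (p.coeff 0) := by
    rcases eq_or_ne p 0 with rfl | hp0
    · simp
    · rw [degree_eq_natDegree hp0] at h1
      norm_cast at h1
      exact eq_C_of_natDegree_eq_zero (by omega)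
  exact ⟨p.coeff 0, by rw [← pairEquiv_C, ← hp, hq]⟩

instance : Infinite W.CoordinateRing :=
  Infinite.of_injective _ (FaithfulSMul.algebraMap_injective F[X] W.CoordinateRing)

end Degree

section FiniteField

variable {F : Type*} [Field F] [Finite F] {W : WeierstrassCurve.Affine F}

instance : Ring.HasFiniteQuotients F[X] where
  finiteQuotient {I} hI := by
    obtain ⟨g, rfl⟩ := Submodule.IsPrincipal.principal I
    have hg : g ≠ 0 := by simpa using hI
    have : Module.Finite F (F[X] ⧸ Ideal.span {g}) := (AdjoinRoot.powerBasis hg).finite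
    exact Module.finite_of_finite F

instance : Ring.HasFiniteQuotients W.CoordinateRing := .of_module_finite F[X] _

instance [W.IsElliptic] : IsDedekindDomain W.CoordinateRing :=
  { isIntegrallyClosed with }

omit [Finite F] in
lemma card_functionsOfDegLE {k : ℕ} (hk : k ≠ 0) :
    Nat.card (functionsOfDegLE W k) = Nat.card F ^ k := by
  rw [Module.natCard_eq_pow_finrank (K := F), finrank_functionsOfDegLE hk]

instance (k : ℕ) : Finite (functionsOfDegLE W k) := Module.finite_of_finite F

/-- The functions in the ideal `I` of degree at most `k`. -/
noncomputable abbrev functionsInOfDegLE (I : Ideal W.CoordinateRing) (k : ℕ) :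
    Submodule F W.CoordinateRing := I.restrictScalars F ⊓ functionsOfDegLE W k

instance (I : Ideal W.CoordinateRing) (k : ℕ) : Finite (functionsInOfDegLE I k) :=
  Finite.of_injective _ (Submodule.inclusion_injective (inf_le_right :
    functionsInOfDegLE I k ≤ functionsOfDegLE W k))

omit [Finite F] in
lemma mem_functionsInOfDegLE {I : Ideal W.CoordinateRing} {k : ℕ} {z : W.CoordinateRing} :
    z ∈ functionsInOfDegLE I k ↔ z ∈ I ∧ deg z ≤ k := by
  rw [Submodule.mem_inf, mem_functionsOfDegLE, Submodule.restrictScalars_mem]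

variable [W.IsElliptic]

lemma exists_span_eq_mul {I : Ideal W.CoordinateRing} {z : W.CoordinateRing}
    (hzI : z ∈ I) (hz : z ≠ 0) : ∃ J, J ≠ ⊥ ∧ Ideal.span {z} = I * J ∧
      deg z = I.codim F + J.codim F := by
  obtain ⟨J, hJ⟩ := Ideal.dvd_span_singleton.2 hzI
  have hne : I * J ≠ ⊥ := hJ ▸ mt Ideal.span_singleton_eq_bot.1 hz
  have hJ0 : J ≠ ⊥ := right_ne_zero_of_mul hne
  exact ⟨J, hJ0, hJ, by rw [← codim_span hz, hJ, codim_mul F (left_ne_zero_of_mul hne) hJ0]⟩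

/-- The Riemann–Roch theorem for divisors of degree one: if `I` has codimension `m`, then the
functions in `I` of degree at most `m + 1` form a line. -/
lemma card_functionsInOfDegLE_codim_add_one {I : Ideal W.CoordinateRing} (hI : I ≠ ⊥) :
    Nat.card (functionsInOfDegLE I (I.codim F + 1)) = Nat.card F := by
  set m := I.codim F with hm
  have hq : 1 < Nat.card F := Finite.one_lt_card
  -- a nonzero such function exists, as there are more functions of degree `≤ m + 1` than classes
  have hex : ∃ z ∈ functionsInOfDegLE I (m + 1), z ≠ 0 := by
    have := Ring.HasFiniteQuotients.finiteQuotient hI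
    have hlt : Nat.card (W.CoordinateRing ⧸ I) < Nat.card (functionsOfDegLE W (m + 1)) := by
      rw [card_functionsOfDegLE m.succ_ne_zero, card_quotient_eq_pow_codim F hI]
      exact Nat.pow_lt_pow_right hq m.lt_succ_self
    have hni : ¬ Function.Injective
        (fun z : functionsOfDegLE W (m + 1) => Ideal.Quotient.mk I z.1) := fun h =>
      hlt.not_ge (Nat.card_le_card_of_injective _ h)
    rw [Function.Injective] at hni
    push Not at hni
    obtain ⟨y, z, hyz, hne⟩ := hni
    exact ⟨y.1 - z.1, ⟨Ideal.Quotient.eq.1 hyz, (y - z).2⟩,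
      fun h => hne (Subtype.ext (sub_eq_zero.1 h))⟩
  obtain ⟨z₀, hz₀, hz₀0⟩ := hex
  apply le_antisymm
  · by_cases h : ∃ z ∈ functionsInOfDegLE I m, z ≠ 0
    · -- `I` is generated by `z`, and no function has degree one
      obtain ⟨z, hz, hz0⟩ := h
      rw [mem_functionsInOfDegLE] at hz
      obtain ⟨J, hJ0, hJ, hdeg⟩ := exists_span_eq_mul hz.1 hz0
      have hJ1 : J = ⊤ := (codim_eq_zero_iff F hJ0).1 (by omega)
      rw [hJ1, Ideal.mul_top] at hJ
      refine Nat.card_le_card_of_surjective (fun c : F => (⟨algebraMap F _ c * z,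
        mem_functionsInOfDegLE.2 ⟨I.mul_mem_left _ hz.1, ?_⟩⟩ : functionsInOfDegLE I (m + 1))) ?_
      · rw [← Algebra.smul_def]
        exact mem_functionsOfDegLE.1
          (Submodule.smul_mem _ _ (mem_functionsOfDegLE.2 (hz.2.trans m.le_succ)))
      · rintro ⟨y, hy⟩
        rw [mem_functionsInOfDegLE, ← hJ, Ideal.mem_span_singleton'] at hy
        obtain ⟨⟨a, rfl⟩, hy⟩ := hy
        rcases eq_or_ne a 0 with rfl | ha
        · exact ⟨0, by simp⟩
        · rw [deg_mul ha hz0] at hy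
          obtain ⟨c, rfl⟩ := exists_algebraMap_eq_of_deg_le_one (z := a) (by omega)
          exact ⟨c, rfl⟩
    -- otherwise the functions of degree at most `m` meet `I` trivially, and they have codimension
    -- one among those of degree at most `m + 1`
    · push Not at h
      have hm0 : m ≠ 0 := by
        rintro h0
        have htop := (codim_eq_zero_iff F hI).1 h0
        refine one_ne_zero (h 1 (mem_functionsInOfDegLE.2 ⟨htop ▸ Submodule.mem_top, ?_⟩))
        rw [← map_one (algebraMap F W.CoordinateRing), deg_algebraMap]
        exact Nat.zero_le _
      have hinj : Function.Injective (fun a : functionsInOfDegLE I (m + 1) × functionsOfDegLE W m =>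
          (⟨a.1.1 + a.2.1, mem_functionsOfDegLE.2 (deg_add_le (mem_functionsOfDegLE.1 a.1.2.2)
            ((mem_functionsOfDegLE.1 a.2.2).trans m.le_succ))⟩ : functionsOfDegLE W (m + 1))) := by
        rintro ⟨a, b⟩ ⟨a', b'⟩ hab
        have hab : a.1 + b.1 = a'.1 + b'.1 := congrArg Subtype.val hab
        have h1 : a.1 - a'.1 = 0 := h _ ⟨(a - a').2.1, by
          rw [sub_eq_iff_eq_add.2 (show a.1 = (b' - b).1 + a'.1 by
            rw [Submodule.coe_sub]; linear_combination hab)]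
          exact (b' - b).2⟩
        obtain rfl : a = a' := Subtype.ext (sub_eq_zero.1 h1)
        rw [add_right_inj] at hab
        rw [Subtype.ext hab]
      have := Nat.card_le_card_of_injective _ hinj
      rw [Nat.card_prod, card_functionsOfDegLE hm0, card_functionsOfDegLE m.succ_ne_zero,
        pow_succ'] at this
      exact Nat.le_of_mul_le_mul_right this (pow_pos (by omega) m)
  · refine Nat.card_le_card_of_injective (fun c : F =>
      (⟨c • z₀, Submodule.smul_mem _ _ hz₀⟩ : functionsInOfDegLE I (m + 1))) fun c d hcd => ?_
    have : c • z₀ = d • z₀ := congrArg Subtype.val hcd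
    exact smul_left_injective F hz₀0 this

omit [W.IsElliptic] in
/-- An ideal of codimension at most one imposes `codim I` conditions on functions. -/
lemma card_functionsInOfDegLE_of_codim_le_one {I : Ideal W.CoordinateRing} (hI : I ≠ ⊥)
    (hc : I.codim F ≤ 1) {k : ℕ} (hk : k ≠ 0) :
    Nat.card (functionsInOfDegLE I k) * Nat.card F ^ I.codim F = Nat.card F ^ k := by
  let g : functionsOfDegLE W k →ₗ[F] W.CoordinateRing ⧸ I :=
    (Ideal.Quotient.mkₐ F I).toLinearMap ∘ₗ (functionsOfDegLE W k).subtype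
  have hconst : ∀ w : W.CoordinateRing ⧸ I, ∃ c : F, c • (1 : W.CoordinateRing ⧸ I) = w := by
    rcases eq_or_ne I ⊤ with h | h
    · have := Ideal.Quotient.subsingleton_iff.2 h
      exact fun w => ⟨0, Subsingleton.elim _ _⟩
    · have := Ideal.Quotient.nontrivial_iff.2 h
      exact (finrank_eq_one_iff_of_nonzero' 1 one_ne_zero).1
        (le_antisymm hc (codim_pos hI h))
  have hg : Function.Surjective g := by
    intro w
    obtain ⟨c, rfl⟩ := hconst w
    refine ⟨⟨algebraMap F _ c, mem_functionsOfDegLE.2 ((deg_algebraMap c).trans_le k.zero_le)⟩, ?_⟩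
    rw [← Algebra.algebraMap_eq_smul_one]
    rfl
  have hker : LinearMap.ker g = (functionsInOfDegLE I k).comap (functionsOfDegLE W k).subtype := by
    ext z
    rw [LinearMap.mem_ker, Submodule.mem_comap, Submodule.mem_inf]
    exact Ideal.Quotient.eq_zero_iff_mem.trans ⟨fun h => ⟨h, z.2⟩, fun h => h.1⟩
  rw [← card_functionsOfDegLE (W := W) hk, Submodule.card_eq_card_quotient_mul_card
    (LinearMap.ker g), Nat.card_congr (g.quotKerEquivOfSurjective hg).toEquiv, hker,
    Nat.card_congr (Submodule.comapSubtypeEquivOfLe inf_le_right).toEquiv,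
    card_quotient_eq_pow_codim F hI]

/-- The nonzero functions in `I` of degree `n`. -/
abbrev FunctionsOfDeg (I : Ideal W.CoordinateRing) (n : ℕ) : Type _ :=
  {z : W.CoordinateRing // z ∈ I ∧ z ≠ 0 ∧ deg z = n}

instance (I : Ideal W.CoordinateRing) (n : ℕ) : Finite (FunctionsOfDeg I n) :=
  Finite.of_injective (fun z => (⟨z.1, mem_functionsOfDegLE.2 z.2.2.2.le⟩ : functionsOfDegLE W n))
    fun _ _ h => Subtype.ext (congrArg (fun z => z.1) h)

omit [W.IsElliptic] in
lemma card_functionsInOfDegLE_succ (I : Ideal W.CoordinateRing) (n : ℕ) :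
    Nat.card (functionsInOfDegLE I (n + 1)) =
      Nat.card (functionsInOfDegLE I n) + Nat.card (FunctionsOfDeg I (n + 1)) := by
  rw [← Nat.card_sum]
  refine Nat.card_congr (Equiv.ofBijective (Sum.elim
    (fun z => ⟨z.1, mem_functionsInOfDegLE.2 ⟨z.2.1,
      (mem_functionsInOfDegLE.1 z.2).2.trans n.le_succ⟩⟩)
    (fun z => ⟨z.1, mem_functionsInOfDegLE.2 ⟨z.2.1, z.2.2.2.le⟩⟩)) ⟨?_, ?_⟩).symm
  · refine Function.Injective.sumElim (fun _ _ h => Subtype.ext (congrArg (fun z => z.1) h))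
      (fun _ _ h => Subtype.ext (congrArg (fun z => z.1) h)) fun y z h => ?_
    have h : y.1 = z.1 := congrArg (fun z => z.1) h
    have := (mem_functionsInOfDegLE.1 y.2).2
    have := z.2.2.2
    rw [h] at *
    omega
  · rintro ⟨z, hz⟩
    rw [mem_functionsInOfDegLE] at hz
    by_cases h : deg z ≤ n
    · exact ⟨.inl ⟨z, mem_functionsInOfDegLE.2 ⟨hz.1, h⟩⟩, rfl⟩
    · exact ⟨.inr ⟨z, hz.1, by rintro rfl; simp at h, by omega⟩, rfl⟩

variable (W) in
/-- The nonzero ideals of codimension `m`. -/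
abbrev IdealsOfCodim (m : ℕ) : Type _ := {I : Ideal W.CoordinateRing // I ≠ ⊥ ∧ I.codim F = m}

instance (m : ℕ) : Finite (IdealsOfCodim W m) := finite_codim_eq F _ m

omit [Finite F] [W.IsElliptic] in
lemma sigma_functionsOfDeg_injective (m n : ℕ) : Function.Injective
    (fun a : Σ I : IdealsOfCodim W m, FunctionsOfDeg I.1 n => (a.1.1, a.2.1)) := by
  rintro ⟨⟨I, hI⟩, ⟨z, hz⟩⟩ ⟨⟨I', hI'⟩, ⟨z', hz'⟩⟩ h
  obtain ⟨h1, h2⟩ := Prod.ext_iff.1 h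
  dsimp only at h1 h2
  subst h1 h2
  rfl

/-- If `z` in `I` has degree `n = m + j`, then `(z) = I J` with `J` of codimension `j`, and `(I, z)`
is recovered from `(J, z)`. -/
lemma card_sigma_functionsOfDeg_le (m j n : ℕ) (h : m + j = n) :
    Nat.card (Σ I : IdealsOfCodim W m, FunctionsOfDeg I.1 n) ≤
      Nat.card (Σ J : IdealsOfCodim W j, FunctionsOfDeg J.1 n) := by
  have hex : ∀ a : Σ I : IdealsOfCodim W m, FunctionsOfDeg I.1 n, ∃ J : Ideal W.CoordinateRing,
      (J ≠ ⊥ ∧ J.codim F = j) ∧ Ideal.span {a.2.1} = a.1.1 * J ∧ a.2.1 ∈ J := by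
    rintro ⟨⟨I, hI, hIm⟩, ⟨z, hzI, hz0, hz⟩⟩
    obtain ⟨J, hJ0, hJ, hdeg⟩ := exists_span_eq_mul (I := I) hzI hz0
    have hmem : z ∈ I * J := hJ ▸ Ideal.mem_span_singleton_self z
    rw [hz, ← h, hIm] at hdeg
    exact ⟨J, ⟨hJ0, (Nat.add_left_cancel hdeg).symm⟩, hJ, Ideal.mul_le_right hmem⟩
  choose J hJ0 hJ hmem using hex
  let φ : (Σ I : IdealsOfCodim W m, FunctionsOfDeg I.1 n) →
      Σ J : IdealsOfCodim W j, FunctionsOfDeg J.1 n :=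
    fun a => ⟨⟨J a, hJ0 a⟩, ⟨a.2.1, hmem a, a.2.2.2⟩⟩
  refine Nat.card_le_card_of_injective φ fun a b hab => sigma_functionsOfDeg_injective m n ?_
  have h1 : J a = J b := congrArg (fun s => s.1.1) hab
  have h2 : a.2.1 = b.2.1 := congrArg (fun s => s.2.1) hab
  have h3 : a.1.1 * J a = b.1.1 * J a := by rw [← hJ a, h2, hJ b, h1]
  exact Prod.ext (mul_right_cancel₀ (hJ0 a).1 h3) h2

lemma card_sigma_functionsOfDeg_comm (m j n : ℕ) (h : m + j = n) :
    Nat.card (Σ I : IdealsOfCodim W m, FunctionsOfDeg I.1 n) =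
      Nat.card (Σ J : IdealsOfCodim W j, FunctionsOfDeg J.1 n) :=
  le_antisymm (card_sigma_functionsOfDeg_le m j n h)
    (card_sigma_functionsOfDeg_le j m n (by omega))

/-- The space `functionsInOfDegLE I (I.codim F + 1)` is a line, and a nonzero function in `I` has
degree at least `I.codim F`. -/
lemma card_functionsOfDeg_codim {I : Ideal W.CoordinateRing} (hI : I ≠ ⊥) :
    Nat.card (FunctionsOfDeg I (I.codim F)) + Nat.card (FunctionsOfDeg I (I.codim F + 1)) + 1 =
      Nat.card F := by
  rw [← card_functionsInOfDegLE_codim_add_one hI, card_functionsInOfDegLE_succ]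
  have : Nat.card (functionsInOfDegLE I (I.codim F)) =
      Nat.card (FunctionsOfDeg I (I.codim F)) + 1 := by
    classical
    rw [← Finite.card_option]
    have hcod : ∀ z ∈ I, z ≠ 0 → I.codim F ≤ deg z := fun z hz hz0 => by
      obtain ⟨J, -, -, h⟩ := exists_span_eq_mul hz hz0
      omega
    refine Nat.card_congr (Equiv.ofBijective (fun o => o.elim 0
      (fun z => ⟨z.1, mem_functionsInOfDegLE.2 ⟨z.2.1, z.2.2.2.le⟩⟩)) ⟨?_, ?_⟩).symm
    · rintro (_ | a) (_ | b) h
      · rfl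
      · exact absurd (congrArg Subtype.val h).symm b.2.2.1
      · exact absurd (congrArg Subtype.val h) a.2.2.1
      · exact congrArg some (Subtype.ext (congrArg (fun z => z.1) h))
    · rintro ⟨z, hz⟩
      rcases eq_or_ne z 0 with rfl | hz0
      · exact ⟨none, rfl⟩
      · have hz' := mem_functionsInOfDegLE.1 hz
        exact ⟨some ⟨z, hz'.1, hz0, le_antisymm hz'.2 (hcod z hz'.1 hz0)⟩, rfl⟩
  omega

omit [W.IsElliptic] in
lemma card_functionsOfDeg_of_codim_le_one {I : Ideal W.CoordinateRing} (hI : I ≠ ⊥)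
    (hc : I.codim F ≤ 1) (n : ℕ) :
    Nat.card (FunctionsOfDeg I (n + 2 + I.codim F)) + Nat.card F ^ (n + 1) =
      Nat.card F ^ (n + 2) := by
  have hq : 0 < Nat.card F ^ I.codim F := pow_pos Nat.card_pos _
  have h1 := card_functionsInOfDegLE_of_codim_le_one hI hc (k := n + 1 + I.codim F) (by omega)
  have h2 := card_functionsInOfDegLE_of_codim_le_one hI hc (k := n + 2 + I.codim F) (by omega)
  rw [show n + 2 + I.codim F = n + 1 + I.codim F + 1 by omega] at h2 ⊢
  rw [card_functionsInOfDegLE_succ, add_mul, h1] at h2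
  apply Nat.eq_of_mul_eq_mul_right hq
  rw [add_mul, ← pow_add, ← pow_add, add_comm, h2]
  congr 1
  omega

/-- The number of ideals of codimension `m ≥ 2` in terms of the number of those of codimension one.
Every ideal `I` of codimension `m` has `q - 1` nonzero functions of degree `m` or `m + 1`; the
complementary ideal of such a function has codimension `0` or `1`, and for those ideals the
functions of degree `m` and `m + 1` can be counted directly. -/
theorem idealCount_add_two (n : ℕ) : idealCount F W.CoordinateRing (n + 2) =
    (1 + idealCount F W.CoordinateRing 1) * Nat.card F ^ (n + 1) := by
  have hT := fun m => Fintype.ofFinite (IdealsOfCodim W m)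
  have hcard : ∀ m, idealCount F W.CoordinateRing m = Fintype.card (IdealsOfCodim W m) :=
    fun m => Nat.card_eq_fintype_card
  have hlow : ∀ j ≤ 1, Nat.card (Σ J : IdealsOfCodim W j, FunctionsOfDeg J.1 (n + 2 + j)) +
      idealCount F W.CoordinateRing j * Nat.card F ^ (n + 1) =
        idealCount F W.CoordinateRing j * Nat.card F ^ (n + 2) := by
    intro j hj
    have h : ∀ J : IdealsOfCodim W j,
        Nat.card (FunctionsOfDeg J.1 (n + 2 + j)) + Nat.card F ^ (n + 1) =
          Nat.card F ^ (n + 2) := by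
      rintro ⟨J, hJ, rfl⟩
      exact card_functionsOfDeg_of_codim_le_one hJ hj n
    have hs := Finset.sum_congr rfl fun J (_ : J ∈ Finset.univ) => h J
    rw [Finset.sum_add_distrib, Finset.sum_const, Finset.sum_const, smul_eq_mul, smul_eq_mul,
      Finset.card_univ, ← hcard, ← Nat.card_sigma] at hs
    exact hs
  have hhigh : ∀ I : IdealsOfCodim W (n + 2), Nat.card (FunctionsOfDeg I.1 (n + 2)) +
      Nat.card (FunctionsOfDeg I.1 (n + 2 + 1)) + 1 = Nat.card F := by
    rintro ⟨I, hI, h⟩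
    have := card_functionsOfDeg_codim hI
    rwa [h] at this
  have hs := Finset.sum_congr rfl fun I (_ : I ∈ Finset.univ) => hhigh I
  rw [Finset.sum_add_distrib, Finset.sum_add_distrib, Finset.sum_const, Finset.sum_const,
    smul_eq_mul, smul_eq_mul, Finset.card_univ, ← hcard, ← Nat.card_sigma, ← Nat.card_sigma,
    card_sigma_functionsOfDeg_comm (n + 2) 0 (n + 2) rfl,
    card_sigma_functionsOfDeg_comm (n + 2) 1 (n + 2 + 1) rfl] at hs
  have h0 := hlow 0 zero_le_one
  have h1 := hlow 1 le_rfl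
  rw [idealCount_zero] at h0
  have hq : 1 < Nat.card F := Finite.one_lt_card
  clear hhigh hlow hcard hT
  rw [pow_succ _ (n + 1)] at h0 h1
  generalize Nat.card F ^ (n + 1) = P at *
  generalize Nat.card F = q at *
  simp only [add_zero] at h0
  apply Nat.eq_of_mul_eq_mul_right (Nat.sub_pos_of_lt hq)
  zify [hq.le] at *
  linear_combination h0 + h1 - hs

end FiniteField

end WeierstrassCurve.Affine.CoordinateRing

/-! ### The trace formula -/

/-- The sequence of power sums of the roots of `x ^ 2 - a x + q`. -/
def powerSumSeq (a q : ℤ) : ℕ → ℤ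
  | 0 => 2
  | 1 => a
  | n + 2 => a * powerSumSeq a q (n + 1) - q * powerSumSeq a q n

namespace PowerSeries

/-- If `A` is the power series of `(1 - a T + q T ^ 2) / (1 - q T)`, then `T A' / A` is the power
series with coefficients `q ^ r` minus the `r`-th power sum of the roots of `x ^ 2 - a x + q`. -/
lemma coeff_eq_of_mul_eq_derivative (a q : ℤ) (A S : ℤ⟦X⟧)
    (hA : A * (1 - C q * X) = 1 - C a * X + C q * X ^ 2)
    (hS : S * A = X * d⁄dX ℤ A) (r : ℕ) :
    coeff (r + 1) S = q ^ (r + 1) - powerSumSeq a q (r + 1) := by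
  set P : ℤ⟦X⟧ := 1 - C a * X + C q * X ^ 2 with hP
  let G : ℤ⟦X⟧ := mk fun n => q ^ n
  let H : ℤ⟦X⟧ := mk (powerSumSeq a q)
  have hG : G * (1 - C q * X) = 1 := by
    ext n
    rw [mul_sub, mul_one, mul_comm, mul_assoc, map_sub, mul_comm X, coeff_C_mul]
    rcases n with _ | n
    · simp [G]
    · rw [coeff_succ_mul_X, coeff_mk, coeff_mk, coeff_one, if_neg n.succ_ne_zero]
      ring
  have hH : H * P = 2 - C a * X := by
    have h0 : ∀ f : ℤ⟦X⟧, f * P = f - C a * (f * X) + C q * (f * X * X) := fun f => by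
      rw [hP]; ring
    rw [h0]
    ext n
    rw [map_add, map_sub, map_sub, coeff_C_mul, coeff_C_mul, coeff_C_mul,
      ← map_ofNat (C (R := ℤ)) 2, coeff_C]
    rcases n with _ | _ | n
    · simp [H, powerSumSeq]
    · rw [coeff_succ_mul_X, coeff_succ_mul_X]
      simp [H, powerSumSeq]
      ring
    · rw [coeff_succ_mul_X, coeff_succ_mul_X, coeff_succ_mul_X, coeff_mk, coeff_mk, coeff_mk,
        powerSumSeq, coeff_X]
      simp
  have hd : d⁄dX ℤ (A * (1 - C q * X)) = d⁄dX ℤ P := by rw [hA]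
  have hu : (1 - C q * X : ℤ⟦X⟧) ≠ 0 := fun h => by
    have := congrArg (coeff 0) h
    simp at this
  have hA0 : A ≠ 0 := fun h => by
    rw [h, zero_mul] at hA
    have := congrArg (coeff 0) hA
    simp [hP] at this
  have hdP : d⁄dX ℤ P = - C a + 2 * C q * X := by
    rw [hP, pow_two]
    simp only [map_add, map_sub, Derivation.leibniz, derivative_C, derivative_X, smul_eq_mul,
      Derivation.map_one_eq_zero]
    ring
  have hd1 : d⁄dX ℤ (1 - C q * X : ℤ⟦X⟧) = - C q := by
    simp only [map_sub, Derivation.leibniz, derivative_C, derivative_X, smul_eq_mul,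
      Derivation.map_one_eq_zero]
    ring
  rw [Derivation.leibniz, smul_eq_mul, smul_eq_mul, hdP, hd1] at hd
  have key : S = (G - 1) - (H - 2) := by
    apply mul_right_cancel₀ hA0
    apply mul_right_cancel₀ hu
    rw [hS]
    have h1 : A * (1 - C q * X) * H = 2 - C a * X := by rw [hA, mul_comm, hH]
    linear_combination X * hd - A * hG + h1 - 2 * hA - hP
  rw [key]
  simp only [map_sub, G, H, coeff_mk, coeff_one, if_neg r.succ_ne_zero, ← map_ofNat (C (R := ℤ)) 2,
    coeff_C]
  ring

end PowerSeries

namespace WeierstrassCurve.Affine.CoordinateRing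

open Polynomial Module
open scoped Polynomial.Bivariate

variable {F : Type*} [Field F] {W : WeierstrassCurve.Affine F}

section Points

variable (K : Type*) [Field K] [Algebra F K]

lemma eval₂_polynomial (x y : K) : W.polynomial.eval₂ (aeval x : F[X] →ₐ[F] K) y =
    (W.map (algebraMap F K)).toAffine.polynomial.evalEval x y := by
  rw [evalEval_polynomial]
  simp [polynomial, eval₂_add, eval₂_mul, eval₂_pow]
  ring

variable {K} in
lemma algHom_algebraMap (χ : W.CoordinateRing →ₐ[F] K) (g : F[X]) :
    χ (algebraMap F[X] W.CoordinateRing g) = aeval (χ (algebraMap F[X] W.CoordinateRing X)) g := by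
  have := aeval_algHom_apply (χ.comp (IsScalarTower.toAlgHom F F[X] W.CoordinateRing)) X g
  rw [aeval_X_left_apply] at this
  exact this.symm

variable (W) in
/-- Homomorphisms from the coordinate ring to `K` are affine points over `K`. -/
noncomputable def algHomEquiv : (W.CoordinateRing →ₐ[F] K) ≃
    {xy : K × K // (W.map (algebraMap F K)).toAffine.Equation xy.1 xy.2} where
  toFun χ := ⟨(χ (algebraMap F[X] _ X), χ (mk W Y)), by
    have h := congrArg χ (mk_Y_sq (W := W))
    rw [map_add, map_mul, map_pow, algHom_algebraMap χ (C W.a₁ * X + C W.a₃),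
      algHom_algebraMap χ (X ^ 3 + C W.a₂ * X ^ 2 + C W.a₄ * X + C W.a₆)] at h
    simp only [map_add, map_mul, map_pow, aeval_X, aeval_C] at h
    rw [equation_iff']
    simp only [map_a₁, map_a₂, map_a₃, map_a₄, map_a₆]
    linear_combination h⟩
  invFun P := AdjoinRoot.liftAlgHom W.polynomial (aeval P.1.1) P.1.2
    ((eval₂_polynomial K P.1.1 P.1.2).trans P.2)
  left_inv χ := by
    refine AdjoinRoot.algHom_ext' ?_ (AdjoinRoot.liftAlgHom_root ..)
    ext
    simp
  right_inv P := by
    refine Subtype.ext (Prod.ext ?_ ?_)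
    · exact (AdjoinRoot.liftAlgHom_of ..).trans (aeval_X _)
    · exact AdjoinRoot.liftAlgHom_root ..

variable [Finite K] [W.IsElliptic]

lemma card_point : Nat.card (W.map (algebraMap F K)).toAffine.Point =
    Nat.card (W.CoordinateRing →ₐ[F] K) + 1 := by
  rw [Nat.card_congr (pointEquiv _), Nat.card_congr (algHomEquiv W K)]
  exact Finite.card_option

end Points

variable [Finite F] [W.IsElliptic]

open PowerSeries in
/-- The trace formula: the zeta function of the affine curve is `(1 - a T + q T ^ 2) / (1 - q T)`,
and its logarithmic derivative counts the points over extensions of `F`. -/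
theorem card_algHom_eq (K : Type*) [Field K] [Algebra F K] [Finite K] :
    (Nat.card (W.CoordinateRing →ₐ[F] K) : ℤ) = (Nat.card F : ℤ) ^ finrank F K -
      powerSumSeq ((Nat.card F : ℤ) - Nat.card (W.CoordinateRing →ₐ[F] F)) (Nat.card F)
        (finrank F K) := by
  set R := W.CoordinateRing
  let A : ℤ⟦X⟧ := PowerSeries.mk fun m => (idealCount F R m : ℤ)
  let S : ℤ⟦X⟧ := PowerSeries.mk fun r => ((∑ d ∈ r.divisors, d * primeCount F R d : ℕ) : ℤ)
  have hS0 : ∀ r, PowerSeries.coeff r S = ((∑ d ∈ r.divisors, d * primeCount F R d : ℕ) : ℤ) :=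
    fun r => PowerSeries.coeff_mk _ _
  have hSA : S * A = PowerSeries.X * d⁄dX ℤ A := by
    ext m
    rw [PowerSeries.coeff_mul, Finset.Nat.sum_antidiagonal_eq_sum_range_succ
      (fun i j => PowerSeries.coeff i S * PowerSeries.coeff j A), Finset.range_eq_Ico,
      Finset.sum_eq_sum_Ico_succ_bot m.succ_pos, hS0, Nat.divisors_zero, Finset.sum_empty,
      Nat.cast_zero, zero_mul, zero_add]
    rcases m with _ | m
    · simp
    · rw [mul_comm PowerSeries.X, PowerSeries.coeff_succ_mul_X, PowerSeries.coeff_derivative,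
        PowerSeries.coeff_mk, mul_comm (idealCount F R (m + 1) : ℤ)]
      have h := congrArg (Nat.cast (R := ℤ)) (mul_idealCount F R (m + 1))
      push_cast at h
      rw [h]
      refine Finset.sum_congr (by ext; simp) fun r _ => ?_
      rw [hS0, PowerSeries.coeff_mk]
      push_cast
      rfl
  have hA1 : Nat.card (R →ₐ[F] F) = idealCount F R 1 := by
    have := mul_idealCount F R 1
    rw [card_algHom_eq_sum_divisors F (R := R) F, finrank_self]
    simpa [idealCount_zero] using this.symm
  -- the zeta function, from the number of ideals of each codimension
  have hA : A * (1 - PowerSeries.C (Nat.card F : ℤ) * PowerSeries.X) =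
      1 - PowerSeries.C ((Nat.card F : ℤ) - Nat.card (R →ₐ[F] F)) * PowerSeries.X +
        PowerSeries.C (Nat.card F : ℤ) * PowerSeries.X ^ 2 := by
    rw [hA1, show A * (1 - PowerSeries.C (Nat.card F : ℤ) * PowerSeries.X) =
      A - PowerSeries.C (Nat.card F : ℤ) * (A * PowerSeries.X) by ring]
    ext m
    rw [map_sub, map_add, map_sub, PowerSeries.coeff_C_mul, PowerSeries.coeff_C_mul,
      PowerSeries.coeff_C_mul, PowerSeries.coeff_X_pow, PowerSeries.coeff_one, PowerSeries.coeff_X]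
    rcases m with _ | _ | _ | m
    · simp [A, idealCount_zero]
    all_goals rw [PowerSeries.coeff_succ_mul_X, PowerSeries.coeff_mk, PowerSeries.coeff_mk]
    · simp [idealCount_zero]
    · have := idealCount_add_two (W := W) 0
      simp only [R, this]
      push_cast
      simp
      ring
    · have h1 := idealCount_add_two (W := W) m
      have h2 := idealCount_add_two (W := W) (m + 1)
      simp only [R, h1, h2]
      push_cast
      simp
      ring
  obtain ⟨r, hr⟩ := Nat.exists_eq_succ_of_ne_zero (finrank_pos (R := F) (M := K)).ne'
  have := PowerSeries.coeff_eq_of_mul_eq_derivative _ _ A S hA hSA r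
  rw [card_algHom_eq_sum_divisors F (R := R) K, hr, ← hS0]
  exact this

end WeierstrassCurve.Affine.CoordinateRing

namespace WeierstrassCurve

open Module

variable {F : Type*} [Field F] [Finite F] (E : WeierstrassCurve F) [E.IsElliptic]

lemma frobeniusTrace_eq :
    E.frobeniusTrace = (Nat.card F : ℤ) - Nat.card (E.toAffine.CoordinateRing →ₐ[F] F) := by
  have := Affine.CoordinateRing.card_point (W := E.toAffine) F
  have h : E.toAffine.map (RingHom.id F) = E := E.map_id
  rw [Algebra.algebraMap_self, h] at this
  rw [frobeniusTrace]
  push_cast [this]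
  ring

/-- The trace over the extension of degree `r` is the `r`-th power sum of the eigenvalues of
Frobenius. -/
theorem frobeniusTraceExt_eq (p : ℕ) [Fact p.Prime] [CharP F p] (r : ℕ) [NeZero r] :
    E.frobeniusTraceExt p r = powerSumSeq E.frobeniusTrace (Nat.card F) r := by
  have h1 := Affine.CoordinateRing.card_point (W := E.toAffine) (FiniteField.Extension F p r)
  have h2 := Affine.CoordinateRing.card_algHom_eq (W := E.toAffine) (FiniteField.Extension F p r)
  rw [FiniteField.finrank_extension, ← frobeniusTrace_eq] at h2
  rw [frobeniusTraceExt, baseChange]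
  push_cast [h1, h2]
  ring

end WeierstrassCurve

/-! ### A lower bound for the number of points -/

namespace WeierstrassCurve.Affine.CoordinateRing

open Polynomial Module
open scoped Polynomial.Bivariate

variable {F : Type*} [Field F] {W : WeierstrassCurve.Affine F}

variable (W) in
/-- The automorphism of the coordinate ring induced by negation on the curve. -/
noncomputable def negHom : W.CoordinateRing →ₐ[F] W.CoordinateRing :=
  AdjoinRoot.liftAlgHom W.polynomial (IsScalarTower.toAlgHom F F[X] W.CoordinateRing)
    (-mk W Y - algebraMap F[X] _ (C W.a₁ * X + C W.a₃)) <| by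
    have h := mk_Y_sq (W := W)
    simp only [polynomial, eval₂_sub, eval₂_add, eval₂_mul, eval₂_pow, eval₂_X, eval₂_C]
    simp only [RingHom.coe_coe, IsScalarTower.coe_toAlgHom'] at h ⊢
    linear_combination h

lemma negHom_algebraMap (g : F[X]) :
    negHom W (algebraMap F[X] _ g) = algebraMap F[X] _ g :=
  AdjoinRoot.liftAlgHom_of ..

lemma negHom_Y : negHom W (mk W Y) = -mk W Y - algebraMap F[X] _ (C W.a₁ * X + C W.a₃) :=
  AdjoinRoot.liftAlgHom_root ..

lemma deg_negHom (z : W.CoordinateRing) : deg (negHom W z) = deg z := by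
  obtain ⟨p, q, rfl⟩ := exists_smul_basis_eq z
  have : negHom W (p • 1 + q • mk W Y) =
      (p - q * (C W.a₁ * X + C W.a₃)) • (1 : W.CoordinateRing) + (-q) • mk W Y := by
    simp only [Algebra.smul_def, map_add, map_mul, negHom_algebraMap, negHom_Y, map_sub, map_neg,
      mul_one]
    ring
  rw [deg, deg, this, norm_smul_basis, norm_smul_basis]
  congr 1
  ring

lemma algHom_ext_of_X_of_Y {A : Type*} [CommRing A] [Algebra F A] {χ ψ : W.CoordinateRing →ₐ[F] A}
    (hX : χ (algebraMap F[X] _ X) = ψ (algebraMap F[X] _ X)) (hY : χ (mk W Y) = ψ (mk W Y)) :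
    χ = ψ := by
  refine AdjoinRoot.algHom_ext' ?_ hY
  ext
  exact hX

/-- Two points with the same `X`-coordinate are equal or opposite. -/
lemma eq_or_eq_comp_negHom {K : Type*} [Field K] [Algebra F K] {χ ψ : W.CoordinateRing →ₐ[F] K}
    (h : χ (algebraMap F[X] _ X) = ψ (algebraMap F[X] _ X)) : ψ = χ ∨ ψ = χ.comp (negHom W) := by
  have hg : ∀ g, χ (algebraMap F[X] _ g) = ψ (algebraMap F[X] _ g) := fun g => by
    rw [algHom_algebraMap, h, ← algHom_algebraMap]
  have h1 := congrArg χ (mk_Y_sq (W := W))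
  have h2 := congrArg ψ (mk_Y_sq (W := W))
  rw [map_add, map_mul, map_pow] at h1 h2
  rw [← hg, ← hg] at h2
  have h3 : (ψ (mk W Y) - χ (mk W Y)) *
      (ψ (mk W Y) - χ (negHom W (mk W Y))) = 0 := by
    rw [negHom_Y, map_sub, map_neg]
    linear_combination h2 - h1
  rcases mul_eq_zero.1 h3 with h3 | h3
  · exact .inl (algHom_ext_of_X_of_Y h.symm (sub_eq_zero.1 h3))
  · refine .inr (algHom_ext_of_X_of_Y ?_ (sub_eq_zero.1 h3))
    rw [AlgHom.comp_apply, negHom_algebraMap, h]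

variable (W) in
/-- A function of degree `n + 2`. -/
noncomputable def functionOfDeg : ℕ → W.CoordinateRing
  | 0 => algebraMap F[X] _ X
  | 1 => mk W Y
  | n + 2 => algebraMap F[X] _ X * functionOfDeg n

lemma deg_X : deg (algebraMap F[X] W.CoordinateRing X) = 2 := by
  have h := norm_smul_basis (W' := W) X 0
  rw [zero_smul, add_zero, ← Algebra.algebraMap_eq_smul_one] at h
  rw [deg, h]
  simp

lemma deg_Y : deg (mk W Y) = 3 := by
  have h := norm_smul_basis (W' := W) 0 1
  rw [zero_smul, zero_add, one_smul] at h
  have h2 : Algebra.norm F[X] (mk W Y) =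
      -(C 1 * X ^ 3 + C W.a₂ * X ^ 2 + C W.a₄ * X + C W.a₆) := by
    rw [h, map_one]
    ring
  rw [deg, h2, natDegree_neg, natDegree_cubic one_ne_zero]

lemma deg_functionOfDeg (n : ℕ) : deg (functionOfDeg W n) = n + 2 := by
  induction n using functionOfDeg.induct with
  | case1 => exact deg_X
  | case2 => exact deg_Y
  | case3 n ih =>
    rw [functionOfDeg, deg_mul, deg_X, ih]
    · omega
    · intro h
      have := deg_X (W := W)
      rw [h, deg_zero] at this
      omega
    · intro h; simp [h] at ih

lemma functionOfDeg_ne_zero (n : ℕ) : functionOfDeg W n ≠ 0 := fun h => by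
  simpa [h] using deg_functionOfDeg (W := W) n

lemma deg_sum_le {ι : Type*} (s : Finset ι) (f : ι → W.CoordinateRing) {k : ℕ}
    (h : ∀ i ∈ s, deg (f i) ≤ k) : deg (∑ i ∈ s, f i) ≤ k :=
  mem_functionsOfDegLE.1 (Submodule.sum_mem _ fun i hi => mem_functionsOfDegLE.2 (h i hi))

lemma deg_mul_le (y z : W.CoordinateRing) : deg (y * z) ≤ deg y + deg z := by
  rcases eq_or_ne y 0 with rfl | hy
  · simp
  rcases eq_or_ne z 0 with rfl | hz
  · simp
  exact (deg_mul hy hz).le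

/-- Combinations of the `s`-th powers of the functions of distinct degrees, with coefficients of
degree less than `s`, have all their terms of distinct degrees. -/
lemma eq_zero_of_sum_mul_functionOfDeg_pow {s : ℕ} (n : ℕ) (ν : ℕ → W.CoordinateRing)
    (hν : ∀ i, deg (ν i) < s) (h : ∑ i ∈ Finset.range n, ν i * functionOfDeg W i ^ s = 0) :
    ∀ i < n, ν i = 0 := by
  induction n with
  | zero => intro i hi; omega
  | succ n ih =>
    have hn : ν n = 0 := by
      by_contra hne
      rw [Finset.sum_range_succ, add_comm, ← eq_neg_iff_add_eq_zero] at h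
      have h1 := congrArg deg h
      rw [deg_mul hne (pow_ne_zero _ (functionOfDeg_ne_zero n)), deg_pow, deg_functionOfDeg] at h1
      have h2 : deg (-∑ i ∈ Finset.range n, ν i * functionOfDeg W i ^ s) ≤ s * (n + 2) - 1 := by
        rw [← Finset.sum_neg_distrib]
        refine deg_sum_le _ _ fun i hi => ?_
        rw [← neg_mul]
        refine (deg_mul_le _ _).trans ?_
        have h3 : deg (-ν i) < s := by
          have := (functionsOfDegLE W _).neg_mem (mem_functionsOfDegLE.2 (le_refl (deg (ν i))))
          exact (mem_functionsOfDegLE.1 this).trans_lt (hν i)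
        rw [deg_pow, deg_functionOfDeg]
        have h4 : s * (i + 2) + s ≤ s * (n + 2) := by
          have := Finset.mem_range.1 hi
          nlinarith
        omega
      have := hν n
      have : 0 < s * (n + 2) := Nat.mul_pos (by omega) (by omega)
      omega
    rw [Finset.sum_range_succ, hn, zero_mul, add_zero] at h
    intro i hi
    rcases Nat.lt_succ_iff_lt_or_eq.1 hi with h' | rfl
    · exact ih h i h'
    · exact hn

variable [Finite F]

/-- A function has at most as many zeros as its degree. -/
lemma card_zeros_le (K : Type*) [Field K] [Algebra F K] {z : W.CoordinateRing} (hz : z ≠ 0) :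
    Finite {χ : W.CoordinateRing →ₐ[F] K // χ z = 0} ∧
      Nat.card {χ : W.CoordinateRing →ₐ[F] K // χ z = 0} ≤ deg z := by
  have := Ring.HasFiniteQuotients.finiteQuotient (mt Ideal.span_singleton_eq_bot.1 hz)
  have : Module.Finite F (W.CoordinateRing ⧸ Ideal.span {z}) := .of_finite
  have hmem : ∀ χ : {χ : W.CoordinateRing →ₐ[F] K // χ z = 0}, ∀ a ∈ Ideal.span {z}, χ.1 a = 0 := by
    intro χ a ha
    obtain ⟨b, rfl⟩ := Ideal.mem_span_singleton'.1 ha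
    rw [map_mul, χ.2, mul_zero]
  let f : {χ : W.CoordinateRing →ₐ[F] K // χ z = 0} →
      ((W.CoordinateRing ⧸ Ideal.span {z}) →ₐ[F] K) :=
    fun χ => Ideal.Quotient.liftₐ _ χ.1 (hmem χ)
  have hf : Function.Injective f := fun χ ψ h => Subtype.ext <| AlgHom.ext fun a =>
    DFunLike.congr_fun h (Ideal.Quotient.mk _ a)
  refine ⟨Finite.of_injective f hf, (Nat.card_le_card_of_injective f hf).trans ?_⟩
  exact (card_algHom_le_finrank F _ K).trans (codim_span hz).le

variable (W) in
/-- The points over `K` which the Frobenius of `F` maps to their opposites. -/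
abbrev FrobeniusNegPoint (K : Type*) [Field K] [Algebra F K] : Type _ :=
  {χ : W.CoordinateRing →ₐ[F] K // ∀ z, χ z ^ Nat.card F = χ (negHom W z)}

/-- An upper bound by Stepanov's method, in the form given by Bombieri. Let `q = s ^ 2`. A
dimension count gives functions `ν i` of degree less than `s`, not all zero, with `∑ ν i ^ s * f i
(-P) = 0`, where `f i` has degree `i + 2`. Then `G = ∑ ν i * f i ^ s` is not zero, and `G ^ s`
takes at `P` with `Frob P = -P` the value `∑ ν i (P) ^ s * f i (Frob P) = ∑ ν i (P) ^ s * f i (-P)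
= 0`, so the number of such points is at most the degree of `G`. -/
lemma card_frobeniusNegPoint_le (p : ℕ) [Fact p.Prime] [CharP F p] (k : ℕ)
    (hF : Nat.card F = (p ^ k) ^ 2) (hk : 4 ≤ p ^ k) (K : Type*) [Field K] [Algebra F K] :
    Finite (FrobeniusNegPoint W K) ∧
      Nat.card (FrobeniusNegPoint W K) ≤ (p ^ k) ^ 2 + 5 * p ^ k := by
  have hcR : CharP W.CoordinateRing p := charP_of_injective_algebraMap
    (FaithfulSMul.algebraMap_injective F W.CoordinateRing) p
  have hcK : CharP K p := charP_of_injective_algebraMap (algebraMap F K).injective p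
  set s := p ^ k with hs
  have hq : 1 < Nat.card F := Finite.one_lt_card
  have hsub : ∀ a b : W.CoordinateRing, (a - b) ^ s = a ^ s - b ^ s := fun a b =>
    sub_pow_char_pow ..
  have hsum : ∀ (t : Finset ℕ) (f : ℕ → K), (∑ i ∈ t, f i) ^ s = ∑ i ∈ t, f i ^ s := fun t f =>
    sum_pow_char_pow ..
  let Φ : (Fin (s + 3) → functionsOfDegLE W (s - 1)) → functionsOfDegLE W ((s - 1) * s + (s + 4)) :=
    fun ν => ⟨∑ i, (ν i).1 ^ s * negHom W (functionOfDeg W i), mem_functionsOfDegLE.2 <| by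
      refine deg_sum_le _ _ fun i _ => (deg_mul_le _ _).trans ?_
      rw [deg_pow, deg_negHom, deg_functionOfDeg, mul_comm]
      exact add_le_add (Nat.mul_le_mul_right _ (mem_functionsOfDegLE.1 (ν i).2)) (by omega)⟩
  -- there are more tuples of functions of degree at most `s - 1` than functions in the target
  have hni : ¬ Function.Injective Φ := fun h => by
    have := Nat.card_le_card_of_injective Φ h
    rw [Nat.card_fun, card_functionsOfDegLE (by omega), card_functionsOfDegLE (by omega),
      Nat.card_fin, ← pow_mul, Nat.pow_le_pow_iff_right hq] at this
    obtain ⟨t, ht⟩ : ∃ t, s = t + 4 := ⟨s - 4, by omega⟩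
    rw [ht, show t + 4 - 1 = t + 3 by omega] at this
    nlinarith
  rw [Function.Injective] at hni
  push Not at hni
  obtain ⟨ν₁, ν₂, hν, hne⟩ := hni
  let ν : ℕ → W.CoordinateRing := fun i => if h : i < s + 3 then ((ν₁ - ν₂) ⟨i, h⟩).1 else 0
  have hνdeg : ∀ i, deg (ν i) < s := fun i => by
    by_cases h : i < s + 3
    · simp only [ν, dif_pos h]
      have := mem_functionsOfDegLE.1 ((ν₁ - ν₂) ⟨i, h⟩).2
      omega
    · simp only [ν, dif_neg h, deg_zero]
      omega
  have hνΦ : ∑ i ∈ Finset.range (s + 3), ν i ^ s * negHom W (functionOfDeg W i) = 0 := by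
    rw [Finset.sum_range]
    have h : ∑ i, (ν₁ i).1 ^ s * negHom W (functionOfDeg W i) =
        ∑ i, (ν₂ i).1 ^ s * negHom W (functionOfDeg W i) := congrArg Subtype.val hν
    rw [← sub_eq_zero, ← Finset.sum_sub_distrib] at h
    rw [← h]
    refine Finset.sum_congr rfl fun i _ => ?_
    simp only [ν, dif_pos i.2, Pi.sub_apply, Submodule.coe_sub]
    rw [hsub, sub_mul]
  set G := ∑ i ∈ Finset.range (s + 3), ν i * functionOfDeg W i ^ s with hG
  have hG0 : G ≠ 0 := fun h => by
    have h0 := eq_zero_of_sum_mul_functionOfDeg_pow _ ν hνdeg h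
    refine hne (funext fun i => Subtype.ext ?_)
    have := h0 i i.2
    simpa [ν, sub_eq_zero] using this
  have hGdeg : deg G ≤ s ^ 2 + 5 * s := by
    refine deg_sum_le _ _ fun i hi => (deg_mul_le _ _).trans ?_
    rw [deg_pow, deg_functionOfDeg]
    have h1 := hνdeg i
    have h2 := Finset.mem_range.1 hi
    have h3 : s * (i + 2) ≤ s * (s + 4) := Nat.mul_le_mul_left _ (by omega)
    nlinarith
  have hzero : ∀ χ : FrobeniusNegPoint W K, χ.1 G = 0 := by
    rintro ⟨χ, hχ⟩
    change χ G = 0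
    refine pow_eq_zero_iff (n := s) (by omega) |>.1 ?_
    have h := congrArg χ hνΦ
    rw [map_zero, map_sum] at h
    rw [← h, hG, map_sum, hsum]
    refine Finset.sum_congr rfl fun i _ => ?_
    rw [map_mul, map_mul, map_pow, map_pow, ← hχ (functionOfDeg W i), mul_pow, ← pow_mul]
    rw [hF, pow_two]
  obtain ⟨hfin, hle⟩ := card_zeros_le K hG0
  let f : FrobeniusNegPoint W K → {χ : W.CoordinateRing →ₐ[F] K // χ G = 0} :=
    fun χ => ⟨χ.1, hzero χ⟩
  have hf : Function.Injective f := fun χ ψ h => Subtype.ext (congrArg (fun a => a.1) h)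
  exact ⟨Finite.of_injective f hf, (Nat.card_le_card_of_injective f hf).trans (hle.trans hGdeg)⟩

omit [Finite F] in
lemma exists_algHom_apply_X_eq (K : Type*) [Field K] [Algebra F K] [IsAlgClosed K] (c : K) :
    ∃ χ : W.CoordinateRing →ₐ[F] K, χ (algebraMap F[X] _ X) = c := by
  obtain ⟨y, hy⟩ := IsAlgClosed.exists_root
    ((W.map (algebraMap F K)).toAffine.polynomial.map (evalRingHom c)) (by
      rw [(monic_polynomial (W := (W.map (algebraMap F K)).toAffine)).degree_map, degree_polynomial]
      exact two_ne_zero)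
  rw [IsRoot.def, eval_map, eval₂_evalRingHom] at hy
  exact ⟨(algHomEquiv W K).symm ⟨(c, y), hy⟩,
    congrArg (fun P => P.1.1) ((algHomEquiv W K).apply_symm_apply ⟨(c, y), hy⟩)⟩

lemma mem_bot_of_pow_card_eq {K : Type*} [Field K] [Algebra F K] {x : K}
    (hx : x ^ Nat.card F = x) : x ∈ (⊥ : Subalgebra F K) := by
  have := Fintype.ofFinite F
  have h1 : 1 < Nat.card F := Finite.one_lt_card
  have hs : (X ^ Nat.card F - X : F[X]).Splits := by
    have := (FiniteField.isSplittingField_sub F F).splits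
    rwa [Algebra.algebraMap_self, Polynomial.map_id, ← Nat.card_eq_fintype_card] at this
  refine hs.mem_range_of_isRoot (FiniteField.X_pow_card_sub_X_ne_zero F h1) ?_
  simp only [Polynomial.map_sub, Polynomial.map_pow, map_X, IsRoot.def, eval_sub, eval_pow, eval_X,
    hx, sub_self]

/-- A point over `K` fixed by the Frobenius of `F` is defined over `F`. -/
lemma exists_algHom_of_pow_card_eq {K : Type*} [Field K] [Algebra F K]
    {χ : W.CoordinateRing →ₐ[F] K} (hχ : ∀ z, χ z ^ Nat.card F = χ z) :
    ∃ χ₀ : W.CoordinateRing →ₐ[F] F, (Algebra.ofId F K).comp χ₀ = χ := by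
  refine ⟨(Algebra.botEquiv F K : (⊥ : Subalgebra F K) →ₐ[F] F).comp
    (χ.codRestrict ⊥ fun z => mem_bot_of_pow_card_eq (hχ z)), ?_⟩
  have h : ∀ y : (⊥ : Subalgebra F K), algebraMap F K (Algebra.botEquiv F K y) = y := fun y => by
    obtain ⟨a, rfl⟩ := (Algebra.botEquiv F K).symm.surjective y
    rw [AlgEquiv.apply_symm_apply]
    rfl
  exact AlgHom.ext fun z => h _

/-- Over each `x` in `F` there are two points which are rational or mapped to their opposites by
Frobenius, counting points that are both rational and equal to their opposites twice. -/
lemma two_mul_card_le (K : Type*) [Field K] [Algebra F K] [IsAlgClosed K]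
    [Finite (FrobeniusNegPoint W K)] : 2 * Nat.card F ≤
      Nat.card (W.CoordinateRing →ₐ[F] F) + Nat.card (FrobeniusNegPoint W K) := by
  have := Fintype.ofFinite F
  have hfin : Finite (W.CoordinateRing →ₐ[F] F) := Finite.of_equiv _ (algHomEquiv W F).symm
  let π : (W.CoordinateRing →ₐ[F] F) ⊕ FrobeniusNegPoint W K → K :=
    Sum.elim (fun χ => algebraMap F K (χ (algebraMap F[X] _ X))) fun χ => χ.1 (algebraMap F[X] _ X)
  have hex : ∀ c : F, ∃ u v, u ≠ v ∧ π u = algebraMap F K c ∧ π v = algebraMap F K c := by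
    intro c
    obtain ⟨χ, hχ⟩ := exists_algHom_apply_X_eq (W := W) K (algebraMap F K c)
    have hneg : (χ.comp (negHom W)) (algebraMap F[X] _ X) = algebraMap F K c := by
      rw [AlgHom.comp_apply, negHom_algebraMap, hχ]
    set ψ := (FiniteField.frobeniusAlgHom F K).comp χ with hψ
    have hψz : ∀ z, ψ z = χ z ^ Nat.card F := fun z => by
      rw [Nat.card_eq_fintype_card]
      rfl
    have hrat : ψ = χ → ∃ χ₀ : W.CoordinateRing →ₐ[F] F, (Algebra.ofId F K).comp χ₀ = χ := fun h =>
      exists_algHom_of_pow_card_eq fun z => by rw [← hψz, h]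
    by_cases h : ψ = χ.comp (negHom W)
    · have h1 : ∀ z, χ z ^ Nat.card F = χ (negHom W z) := fun z => by
        rw [← hψz, h, AlgHom.comp_apply]
      let u : FrobeniusNegPoint W K := ⟨χ, h1⟩
      by_cases h2 : χ.comp (negHom W) = χ
      · obtain ⟨χ₀, hχ₀⟩ := hrat (h.trans h2)
        exact ⟨.inl χ₀, .inr u, Sum.inl_ne_inr, (DFunLike.congr_fun hχ₀ _).trans hχ, hχ⟩
      · let v : FrobeniusNegPoint W K := ⟨χ.comp (negHom W), fun z => h1 (negHom W z)⟩
        refine ⟨.inr u, .inr v, fun huv => h2 ?_, hχ, hneg⟩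
        exact congrArg Subtype.val (Sum.inr_injective huv).symm
    · have h1 : ψ = χ := by
        refine (eq_or_eq_comp_negHom (χ := χ) (ψ := ψ) ?_).resolve_right h
        rw [hψz, hχ, ← map_pow, Nat.card_eq_fintype_card, FiniteField.pow_card]
      obtain ⟨χ₀, hχ₀⟩ := hrat h1
      refine ⟨.inl χ₀, .inl (χ₀.comp (negHom W)), fun huv => h ?_,
        (DFunLike.congr_fun hχ₀ _).trans hχ, ?_⟩
      · rw [h1, ← hχ₀, AlgHom.comp_assoc, ← Sum.inl_injective huv]
      · rw [← hneg, ← hχ₀]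
        rfl
  choose u v huv hu hv using hex
  let f : F × Bool → (W.CoordinateRing →ₐ[F] F) ⊕ FrobeniusNegPoint W K :=
    fun a => if a.2 then u a.1 else v a.1
  have hπf : ∀ a, π (f a) = algebraMap F K a.1 := by
    rintro ⟨c, _ | _⟩
    exacts [hv c, hu c]
  have hf : Function.Injective f := by
    rintro ⟨c, b⟩ ⟨c', b'⟩ h
    have hc : c = c' := (algebraMap F K).injective (by rw [← hπf (c, b), ← hπf (c', b'), h])
    subst hc
    cases b <;> cases b'
    · rfl
    · exact absurd h.symm (huv c)
    · exact absurd h (huv c)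
    · rfl
  have := Nat.card_le_card_of_injective f hf
  rw [Nat.card_prod, Nat.card_sum, Nat.card_eq_fintype_card (α := Bool), Fintype.card_bool,
    mul_comm] at this
  exact this

/-- A lower bound for the number of affine points over a finite field of square order. -/
theorem card_le_card_algHom_add (p : ℕ) [Fact p.Prime] [CharP F p] (k : ℕ)
    (hF : Nat.card F = (p ^ k) ^ 2) (hk : 4 ≤ p ^ k) :
    Nat.card F ≤ Nat.card (W.CoordinateRing →ₐ[F] F) + 5 * p ^ k := by
  obtain ⟨h1, h2⟩ := card_frobeniusNegPoint_le (W := W) p k hF hk (AlgebraicClosure F)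
  have := two_mul_card_le (W := W) (AlgebraicClosure F)
  omega

end WeierstrassCurve.Affine.CoordinateRing

/-! ### The Hasse bound and the Frobenius angle -/

lemma powerSumSeq_eq_pow_add_pow {R : Type*} [CommRing R] {a q : ℤ} {α β : R}
    (hadd : α + β = a) (hmul : α * β = q) : ∀ r, (powerSumSeq a q r : R) = α ^ r + β ^ r
  | 0 => by simp [powerSumSeq]; norm_num
  | 1 => by simp [powerSumSeq, hadd]
  | r + 2 => by
    rw [powerSumSeq]
    push_cast [powerSumSeq_eq_pow_add_pow hadd hmul (r + 1),
      powerSumSeq_eq_pow_add_pow hadd hmul r, ← hadd, ← hmul]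
    ring

/-- If the even power sums of the roots of `X ^ 2 - a X + q` have order of magnitude `√q ^ r`, then
both roots have absolute value `√q`. -/
lemma sq_le_four_mul_of_powerSumSeq_le {a q C : ℤ} (hq : 0 < q)
    (h : ∀ m, 2 ≤ m → powerSumSeq a q (2 * m) ≤ C * q ^ m) : a ^ 2 ≤ 4 * q := by
  by_contra! hlt
  have hq' : (0 : ℝ) < q := mod_cast hq
  have hlt' : (4 * q : ℝ) < a ^ 2 := mod_cast hlt
  set d : ℝ := √((a : ℝ) ^ 2 - 4 * q)
  have hd : d ^ 2 = (a : ℝ) ^ 2 - 4 * q := Real.sq_sqrt (by linarith)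
  set α : ℝ := (a + d) / 2 with hα
  set β : ℝ := (a - d) / 2 with hβ
  have hs := powerSumSeq_eq_pow_add_pow (R := ℝ) (a := a) (q := q) (α := α) (β := β)
    (by rw [hα, hβ]; ring) (by rw [hα, hβ]; linear_combination -hd / 4)
  obtain ⟨x, hx, hxm⟩ : ∃ x : ℝ, q < x ∧ ∀ m, x ^ m ≤ powerSumSeq a q (2 * m) := by
    have hsum : α ^ 2 + β ^ 2 = (a : ℝ) ^ 2 - 2 * q := by
      rw [hα, hβ]; linear_combination hd / 2
    rcases lt_or_ge (q : ℝ) (α ^ 2) with h1 | h1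
    · refine ⟨α ^ 2, h1, fun m => ?_⟩
      rw [hs, pow_mul, pow_mul]
      linarith [pow_nonneg (sq_nonneg β) m]
    · refine ⟨β ^ 2, by linarith, fun m => ?_⟩
      rw [hs, pow_mul, pow_mul]
      linarith [pow_nonneg (sq_nonneg α) m]
  have htop := tendsto_pow_atTop_atTop_of_one_lt ((one_lt_div hq').2 hx)
  obtain ⟨m, hm, hm2⟩ := ((htop.eventually_gt_atTop (C : ℝ)).and (eventually_ge_atTop 2)).exists
  have h1 : (powerSumSeq a q (2 * m) : ℝ) ≤ C * q ^ m := mod_cast h m hm2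
  rw [div_pow, lt_div_iff₀ (pow_pos hq' m)] at hm
  linarith [hxm m]

/-- The power sums of the roots `√q e ^ (± i θ)` of `X ^ 2 - a X + q`. -/
lemma powerSumSeq_eq_cos {a q : ℤ} {θ s : ℝ} (hs : s ^ 2 = q) (ha : (a : ℝ) = 2 * s * Real.cos θ) :
    ∀ r : ℕ, (powerSumSeq a q r : ℝ) = 2 * s ^ r * Real.cos (r * θ)
  | 0 => by simp [powerSumSeq]
  | 1 => by simp [powerSumSeq, ha]
  | r + 2 => by
    rw [powerSumSeq]
    push_cast [powerSumSeq_eq_cos hs ha (r + 1), powerSumSeq_eq_cos hs ha r, ha, ← hs]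
    have h1 := Real.cos_add ((r + 1) * θ) θ
    have h2 := Real.cos_sub ((r + 1) * θ) θ
    rw [show ((r : ℝ) + 1) * θ + θ = (r + 2) * θ by ring] at h1
    rw [show ((r : ℝ) + 1) * θ - θ = r * θ by ring] at h2
    linear_combination -2 * s ^ (r + 2) * (h1 + h2)

lemma powerSumSeq_modEq {a q p : ℤ} (hp : p ∣ q) :
    ∀ r : ℕ, powerSumSeq a q (r + 1) ≡ a ^ (r + 1) [ZMOD p]
  | 0 => by simp [powerSumSeq, Int.ModEq.refl]
  | r + 1 => by
    rw [powerSumSeq, pow_succ' a (r + 1)]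
    have h := ((powerSumSeq_modEq (a := a) hp r).mul_left a).sub
      ((Int.modEq_zero_iff_dvd.2 hp).mul_right (powerSumSeq a q r))
    simpa using h

/-- If `p` divides `q` but not `a`, then the argument of the roots of `X ^ 2 - a X + q` is not a
rational multiple of `π`: otherwise some power sum of the roots would be twice a power of `q`. -/
lemma cos_mul_ne_one {a q p : ℤ} (hp : Prime p) (hpq : p ∣ q) (hpa : ¬ p ∣ a) {θ s : ℝ}
    (hs : s ^ 2 = q) (ha : (a : ℝ) = 2 * s * Real.cos θ) {n : ℕ} (hn : n ≠ 0) :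
    Real.cos (n * θ) ≠ 1 := by
  intro h
  have h2 : Real.cos ((2 * n : ℕ) * θ) = 1 := by
    push_cast
    rw [mul_assoc, Real.cos_two_mul, h]
    norm_num
  have h3 : powerSumSeq a q (2 * n) = 2 * q ^ n := by
    have := powerSumSeq_eq_cos hs ha (2 * n)
    rw [h2, pow_mul, hs] at this
    rw [mul_one] at this
    exact_mod_cast this
  obtain ⟨m, hm⟩ : ∃ m, 2 * n = m + 1 := Nat.exists_eq_succ_of_ne_zero (by omega)
  have h4 := powerSumSeq_modEq (a := a) hpq m
  rw [← hm, h3] at h4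
  have h5 : p ∣ 2 * q ^ n := (dvd_pow hpq hn).mul_left 2
  exact hpa (hp.dvd_of_dvd_pow ((Int.ModEq.dvd_iff h4).1 h5))

namespace WeierstrassCurve

variable {F : Type*} [Field F] [Finite F] (p : ℕ) [Fact p.Prime] [CharP F p]
  (E : WeierstrassCurve F) [E.IsElliptic]

lemma frobeniusTraceExt_two_mul_le {m : ℕ} (hm : 2 ≤ m) [NeZero (2 * m)] :
    E.frobeniusTraceExt p (2 * m) ≤ 5 * (Nat.card F : ℤ) ^ m := by
  let K := FiniteField.Extension F p (2 * m)
  have : CharP K p := charP_of_injective_algebraMap (algebraMap F K).injective p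
  have := Fintype.ofFinite F
  obtain ⟨f, -, hf⟩ := FiniteField.card F p
  rw [← Nat.card_eq_fintype_card] at hf
  have hK : Nat.card K = Nat.card F ^ (2 * m) := FiniteField.natCard_extension F p (2 * m)
  have hpk : p ^ (f * m : ℕ) = Nat.card F ^ m := by rw [hf, pow_mul]
  have h4 : 4 ≤ p ^ (f * m : ℕ) := by
    rw [hpk]
    calc 4 = 2 ^ 2 := rfl
      _ ≤ Nat.card F ^ 2 := Nat.pow_le_pow_left Finite.one_lt_card 2
      _ ≤ Nat.card F ^ m := Nat.pow_le_pow_right Nat.card_pos hm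
  have h1 := Affine.CoordinateRing.card_le_card_algHom_add
    (W := (E.baseChange K).toAffine) p (f * m) (by rw [hK, hpk]; ring) h4
  have : (E.baseChange K).IsElliptic :=
    inferInstanceAs (E.map (algebraMap F K)).IsElliptic
  have h2 := frobeniusTrace_eq (E.baseChange K)
  rw [frobeniusTrace] at h2
  rw [frobeniusTraceExt]
  zify at h1 hK hpk
  rw [hpk] at h1
  rw [hK] at h1 h2
  linarith

/-- **Hasse's theorem**. -/
theorem frobeniusTrace_sq_le : E.frobeniusTrace ^ 2 ≤ 4 * Nat.card F := by
  refine sq_le_four_mul_of_powerSumSeq_le (C := 5) (mod_cast Nat.card_pos) fun m hm => ?_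
  obtain ⟨p, hp⟩ := CharP.exists F
  have : Fact p.Prime := ⟨(CharP.char_is_prime_or_zero F p).resolve_right fun h0 => by
    subst h0
    have := CharP.charP_to_charZero F
    exact not_finite F⟩
  have : NeZero (2 * m) := ⟨by omega⟩
  rw [← frobeniusTraceExt_eq E p]
  exact frobeniusTraceExt_two_mul_le p E hm

/-- The eigenvalues of the Frobenius endomorphism of `E` are `√q e ^ (± i θ)`, where `θ` is
`frobeniusAngle E`. -/
noncomputable def frobeniusAngle : ℝ :=
  Real.arccos (E.frobeniusTrace / (2 * √(Nat.card F)))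

lemma frobeniusTrace_eq_cos :
    (E.frobeniusTrace : ℝ) = 2 * √(Nat.card F) * Real.cos E.frobeniusAngle := by
  have hq : (0 : ℝ) < 2 * √(Nat.card F) := by
    have : 0 < Nat.card F := Nat.card_pos
    positivity
  have h : (E.frobeniusTrace : ℝ) ^ 2 ≤ (2 * √(Nat.card F)) ^ 2 := by
    rw [mul_pow, Real.sq_sqrt (Nat.cast_nonneg _)]
    have := E.frobeniusTrace_sq_le
    norm_num
    exact_mod_cast this
  have h' := abs_le_of_sq_le_sq' h hq.le
  rw [frobeniusAngle, Real.cos_arccos, mul_div_cancel₀ _ hq.ne']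
  · rw [le_div_iff₀ hq]
    linarith
  · rw [div_le_one hq]
    exact h'.2

theorem normalizedTrace_eq_cos (r : ℕ) [NeZero r] :
    E.normalizedTrace p r = 2 * Real.cos (r * E.frobeniusAngle) := by
  have hq : (0 : ℝ) < Nat.card F := mod_cast Nat.card_pos
  have hs : √(Nat.card F : ℝ) ^ 2 = ((Nat.card F : ℤ) : ℝ) := by
    rw [Real.sq_sqrt hq.le, Int.cast_natCast]
  have hpow : (Nat.card F : ℝ) ^ ((r : ℝ) / 2) = √(Nat.card F : ℝ) ^ r := by
    rw [Real.sqrt_eq_rpow, ← Real.rpow_mul_natCast hq.le]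
    ring_nf
  rw [normalizedTrace, frobeniusTraceExt_eq, powerSumSeq_eq_cos hs E.frobeniusTrace_eq_cos, hpow,
    div_eq_iff (by positivity)]
  ring

variable {E p} in
lemma IsOrdinary.cos_mul_frobeniusAngle_ne_one (hE : E.IsOrdinary p) {n : ℕ} (hn : n ≠ 0) :
    Real.cos (n * E.frobeniusAngle) ≠ 1 := by
  refine cos_mul_ne_one (q := Nat.card F) (Nat.prime_iff_prime_int.1 (Fact.out : p.Prime)) ?_ hE
    (by rw [Real.sq_sqrt (Nat.cast_nonneg _), Int.cast_natCast]) E.frobeniusTrace_eq_cos hn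
  have := Fintype.ofFinite F
  obtain ⟨f, -, hf⟩ := FiniteField.card F p
  rw [← Nat.card_eq_fintype_card] at hf
  rw [hf]
  exact_mod_cast dvd_pow_self p f.ne_zero

end WeierstrassCurve

/-! ### Equidistribution of `2 cos (r θ)` -/

section Equidistribution

/-- Means over the terms of a sequence converge to the integral for all continuous functions as
soon as they do for a family of functions with dense linear span. -/
theorem isEquidistributed_of_span_dense {X : Type*} [TopologicalSpace X] [CompactSpace X]
    [MeasurableSpace X] [BorelSpace X] {μ : Measure X} [IsProbabilityMeasure μ] {x : ℕ → X}
    {S : Set C(X, ℝ)} (hS : (Submodule.span ℝ S).topologicalClosure = ⊤)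
    (h : ∀ f ∈ S, Tendsto (fun n : ℕ => (1 / (n : ℝ)) * ∑ i ∈ Finset.range n, f (x i)) atTop
      (𝓝 (∫ z, f z ∂μ))) :
    IsEquidistributed μ x := by
  have hint : ∀ f : C(X, ℝ), Integrable f μ := fun f =>
    Integrable.of_bound f.continuous.aestronglyMeasurable ‖f‖ (ae_of_all _ f.norm_coe_le_norm)
  let D : ℕ → C(X, ℝ) →ₗ[ℝ] ℝ := fun n =>
    { toFun := fun f => (1 / (n : ℝ)) * ∑ i ∈ Finset.range n, f (x i) - ∫ z, f z ∂μ
      map_add' := fun f g => by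
        simp only [ContinuousMap.add_apply, Finset.sum_add_distrib,
          integral_add (hint f) (hint g)]
        ring
      map_smul' := fun c f => by
        simp only [ContinuousMap.smul_apply, smul_eq_mul, ← Finset.mul_sum, integral_const_mul,
          RingHom.id_apply]
        ring }
  have hD : ∀ n f, |D n f| ≤ 2 * ‖f‖ := by
    intro n f
    have h1 : |∑ i ∈ Finset.range n, f (x i)| ≤ n * ‖f‖ := by
      refine (Finset.abs_sum_le_sum_abs _ _).trans ?_
      refine (Finset.sum_le_card_nsmul _ _ _ fun i _ => f.norm_coe_le_norm (x i)).trans_eq ?_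
      simp
    have h2 : |∫ z, f z ∂μ| ≤ ‖f‖ := by
      simpa using norm_integral_le_of_norm_le_const (μ := μ) (ae_of_all _ f.norm_coe_le_norm)
    have h3 : |(1 / (n : ℝ)) * ∑ i ∈ Finset.range n, f (x i)| ≤ ‖f‖ := by
      rw [abs_mul, abs_of_nonneg (by positivity), one_div_mul_eq_div]
      rcases Nat.eq_zero_or_pos n with rfl | hn
      · simp
      · rw [div_le_iff₀ (by positivity), mul_comm ‖f‖]
        exact h1
    calc |D n f| ≤ _ := abs_sub _ _
      _ ≤ 2 * ‖f‖ := by linarith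
  let V : Submodule ℝ C(X, ℝ) :=
    { carrier := {f | Tendsto (fun n => D n f) atTop (𝓝 0)}
      zero_mem' := by simp
      add_mem' := fun {f g} hf hg => by simpa using Tendsto.add hf hg
      smul_mem' := fun c f hf => by simpa using Tendsto.const_mul c hf }
  -- `V` is closed, by equicontinuity of the functionals `D n`
  have hV : V = ⊤ := by
    have hSV : Submodule.span ℝ S ≤ V := Submodule.span_le.2 fun f hf => by
      change Tendsto (fun n => D n f) atTop (𝓝 0)
      simpa [D] using (h f hf).sub_const (∫ z, f z ∂μ)
    refine top_le_iff.1 (hS ▸ Submodule.topologicalClosure_minimal _ hSV ?_)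
    refine isClosed_of_closure_subset fun f hf => ?_
    refine Metric.tendsto_atTop.2 fun ε hε => ?_
    obtain ⟨g, hg, hfg⟩ := Metric.mem_closure_iff.1 hf (ε / 4) (by positivity)
    obtain ⟨N, hN⟩ := Metric.tendsto_atTop.1 hg (ε / 2) (by positivity)
    refine ⟨N, fun n hn => ?_⟩
    have h1 := hN n hn
    have h2 := hD n (f - g)
    rw [dist_eq_norm] at hfg
    rw [Real.dist_eq, sub_zero] at h1 ⊢
    rw [map_sub] at h2
    calc |D n f| = |(D n f - D n g) + D n g| := by ring_nf
      _ ≤ |D n f - D n g| + |D n g| := abs_add_le _ _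
      _ < ε := by linarith
  have hreal : ∀ f : C(X, ℝ), Tendsto (fun n : ℕ => (1 / (n : ℝ)) * ∑ i ∈ Finset.range n, f (x i))
      atTop (𝓝 (∫ z, f z ∂μ)) := fun f => by
    have hf : f ∈ V := hV ▸ Submodule.mem_top
    exact tendsto_sub_nhds_zero_iff.1 hf
  intro f
  let u : C(X, ℝ) := ⟨fun z => (f z).re, by fun_prop⟩
  let v : C(X, ℝ) := ⟨fun z => (f z).im, by fun_prop⟩
  have hf : ∀ z, f z = (u z : ℂ) + (v z : ℂ) * Complex.I := fun z => (Complex.re_add_im _).symm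
  have hlim := ((Complex.continuous_ofReal.tendsto _).comp (hreal u)).add
    (((Complex.continuous_ofReal.tendsto _).comp (hreal v)).mul_const Complex.I)
  have hval : ∫ z, f z ∂μ = ((∫ z, u z ∂μ : ℝ) : ℂ) + ((∫ z, v z ∂μ : ℝ) : ℂ) * Complex.I := by
    simp only [hf]
    rw [integral_add (hint u).ofReal ((hint v).ofReal.mul_const _), integral_mul_const,
      integral_complex_ofReal, integral_complex_ofReal]
  rw [hval]
  refine hlim.congr fun n => ?_
  simp only [Function.comp_apply, hf, Finset.sum_add_distrib, ← Finset.sum_mul]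
  push_cast
  ring

open Polynomial Polynomial.Chebyshev

/-- The Chebyshev polynomial `T_k(z / 2)` as a function on `[-2, 2]`; its value at `2 cos θ` is
`cos (k θ)`. -/
noncomputable def scaledChebyshev (k : ℕ) : C(Set.Icc (-2 : ℝ) 2, ℝ) :=
  ⟨fun z => (T ℝ k).eval ((z : ℝ) / 2), by fun_prop⟩

/-- The span is closed under multiplication by `z`, so it contains all polynomials. -/
lemma span_scaledChebyshev :
    (Submodule.span ℝ (Set.range scaledChebyshev)).topologicalClosure = ⊤ := by
  set V := Submodule.span ℝ (Set.range scaledChebyshev)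
  have hT : ∀ k, scaledChebyshev k ∈ V := fun k => Submodule.subset_span ⟨k, rfl⟩
  let Z : C(Set.Icc (-2 : ℝ) 2, ℝ) := ⟨fun z => z, by fun_prop⟩
  have hZ : ∀ g ∈ V, Z * g ∈ V := by
    intro g hg
    refine Submodule.span_induction ?_ ?_ ?_ ?_ hg
    · rintro _ ⟨k, rfl⟩
      rcases k with _ | k
      · convert V.smul_mem (2 : ℝ) (hT 1) using 1
        ext z
        simp [Z, scaledChebyshev]
        ring
      · convert V.add_mem (hT (k + 2)) (hT k) using 1
        ext z
        have := congrArg (Polynomial.eval ((z : ℝ) / 2)) (T_add_two ℝ k)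
        simp only [eval_sub, eval_mul, eval_X, eval_ofNat] at this
        have hz : (T ℝ ((k : ℤ) + 2)).eval ((z : ℝ) / 2) + (T ℝ k).eval ((z : ℝ) / 2) =
            z * (T ℝ ((k : ℤ) + 1)).eval ((z : ℝ) / 2) := by
          rw [this]
          ring
        simpa [Z, scaledChebyshev] using hz.symm
    · simp
    · intro f g _ _ hf hg
      rw [mul_add]
      exact V.add_mem hf hg
    · intro c f _ hf
      rw [mul_smul_comm]
      exact V.smul_mem c hf
  have hle : (polynomialFunctions (Set.Icc (-2 : ℝ) 2) : Set C(Set.Icc (-2 : ℝ) 2, ℝ)) ⊆ V := by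
    rintro _ ⟨P, -, rfl⟩
    simp only [RingHom.coe_coe, SetLike.mem_coe]
    induction P using Polynomial.induction_on' with
    | add P Q hP hQ =>
      rw [map_add]
      exact V.add_mem hP hQ
    | monomial n c =>
      induction n with
      | zero =>
        convert V.smul_mem c (hT 0) using 1
        ext z
        simp [scaledChebyshev]
      | succ n ih =>
        convert hZ _ ih using 1
        ext z
        simp [Z, pow_succ]
        ring
  have hd := polynomialFunctions_closure_eq_top (-2 : ℝ) 2
  refine SetLike.coe_injective ?_
  rw [Submodule.topologicalClosure_coe, Submodule.top_coe, ← Set.univ_subset_iff]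
  have : closure (polynomialFunctions (Set.Icc (-2 : ℝ) 2) : Set C(Set.Icc (-2 : ℝ) 2, ℝ))
      = Set.univ := by
    rw [← Subalgebra.topologicalClosure_coe, hd, Algebra.coe_top]
  exact this ▸ closure_mono hle

/-- The substitution `z = 2 x`. The formula holds for all `f`, as scaling the variable preserves the
junk value `0` of the integral of a function that is not integrable. -/
lemma integral_arcsineMeasure (f : ℝ → ℝ) :
    ∫ z, f z ∂arcsineMeasure = 1 / Real.pi * ∫ x, f (2 * x) ∂measureT := by
  have hmeas : Measurable fun z : Set.Icc (-2 : ℝ) 2 =>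
      ENNReal.ofReal (1 / Real.pi * (1 / √(4 - (z : ℝ) ^ 2))) := by fun_prop
  rw [arcsineMeasure, integral_withDensity_eq_integral_toReal_smul hmeas (by simp),
    integral_subtype_comap measurableSet_Icc
      (fun z : ℝ => (ENNReal.ofReal (1 / Real.pi * (1 / √(4 - z ^ 2)))).toReal • f z),
    integral_Icc_eq_integral_Ioc, ← intervalIntegral.integral_of_le (by norm_num),
    integral_measureT]
  have := intervalIntegral.smul_integral_comp_mul_left (a := -1) (b := 1)
    (fun z : ℝ => (ENNReal.ofReal (1 / Real.pi * (1 / √(4 - z ^ 2)))).toReal • f z) 2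
  norm_num at this
  norm_num
  rw [← this, ← intervalIntegral.integral_const_mul, ← intervalIntegral.integral_const_mul]
  refine intervalIntegral.integral_congr fun x _ => ?_
  rw [ENNReal.toReal_ofReal (by positivity), show 4 - (2 * x) ^ 2 = 2 ^ 2 * (1 - x ^ 2) by ring,
    Real.sqrt_mul (by positivity), Real.sqrt_sq (by norm_num), mul_inv]
  ring

instance isProbabilityMeasure_arcsineMeasure : IsProbabilityMeasure arcsineMeasure := by
  have h := integral_arcsineMeasure fun _ => 1
  have h0 := integral_eval_T_real_measureT_zero
  simp only [T_zero, eval_one] at h0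
  rw [h0, one_div_mul_cancel Real.pi_ne_zero, integral_const (1 : ℝ), smul_eq_mul, mul_one] at h
  constructor
  rwa [measureReal_def, ENNReal.toReal_eq_one_iff] at h

lemma integral_scaledChebyshev (k : ℕ) :
    ∫ z, scaledChebyshev k z ∂arcsineMeasure = if k = 0 then 1 else 0 := by
  have h := integral_arcsineMeasure fun z => (T ℝ k).eval (z / 2)
  simp only [mul_div_cancel_left₀ _ (two_ne_zero (α := ℝ))] at h
  refine h.trans ?_
  split_ifs with hk
  · subst hk
    rw [Nat.cast_zero, integral_eval_T_real_measureT_zero, one_div_mul_cancel Real.pi_ne_zero]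
  · rw [integral_eval_T_real_measureT_of_ne_zero (mod_cast hk), mul_zero]

/-- The sum is the real part of a geometric series with ratio `e ^ (i φ) ≠ 1`, which is bounded. -/
lemma tendsto_mean_cos {φ : ℝ} (hφ : Real.cos φ ≠ 1) :
    Tendsto (fun n : ℕ => (1 / (n : ℝ)) * ∑ i ∈ Finset.range n, Real.cos ((i + 1 : ℕ) * φ)) atTop
      (𝓝 0) := by
  set w : ℂ := Complex.exp (φ * Complex.I)
  have hw : w ≠ 1 := fun h => hφ (by
    have := congrArg Complex.re h
    rwa [Complex.exp_ofReal_mul_I_re, Complex.one_re] at this)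
  have hw1 : ‖w‖ = 1 := Complex.norm_exp_ofReal_mul_I φ
  have hsum : ∀ n : ℕ, ∑ i ∈ Finset.range n, Real.cos ((i + 1 : ℕ) * φ) =
      (w * ((w ^ n - 1) / (w - 1))).re := by
    intro n
    rw [← geom_sum_eq hw, Finset.mul_sum, Complex.re_sum]
    refine Finset.sum_congr rfl fun i _ => ?_
    rw [← pow_succ', ← Complex.exp_nat_mul, ← mul_assoc, ← Complex.ofReal_natCast,
      ← Complex.ofReal_mul, Complex.exp_ofReal_mul_I_re]
  have hbound : ∀ n : ℕ, |∑ i ∈ Finset.range n, Real.cos ((i + 1 : ℕ) * φ)| ≤ 2 / ‖w - 1‖ := by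
    intro n
    rw [hsum]
    refine (Complex.abs_re_le_norm _).trans ?_
    rw [norm_mul, hw1, one_mul, norm_div]
    gcongr
    refine (norm_sub_le _ _).trans ?_
    rw [norm_pow, hw1, one_pow, norm_one]
    norm_num
  refine squeeze_zero_norm (a := fun n : ℕ => (1 / (n : ℝ)) * (2 / ‖w - 1‖)) (fun n => ?_) ?_
  · rw [norm_mul, Real.norm_of_nonneg (by positivity : (0 : ℝ) ≤ 1 / n)]
    gcongr
    exact hbound n
  · simpa using tendsto_one_div_atTop_nhds_zero_nat.mul_const (2 / ‖w - 1‖)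

/-- **Weyl's criterion** for the points `2 cos (r θ)`, with `θ` an irrational multiple of `π`. -/
theorem isEquidistributed_two_mul_cos {θ : ℝ} (hθ : ∀ n : ℕ, n ≠ 0 → Real.cos (n * θ) ≠ 1)
    {x : ℕ → Set.Icc (-2 : ℝ) 2} (hx : ∀ i, (x i : ℝ) = 2 * Real.cos ((i + 1 : ℕ) * θ)) :
    IsEquidistributed arcsineMeasure x := by
  refine isEquidistributed_of_span_dense span_scaledChebyshev ?_
  rintro _ ⟨k, rfl⟩
  have hval : ∀ i, scaledChebyshev k (x i) = Real.cos ((i + 1 : ℕ) * (k * θ)) := by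
    intro i
    change (T ℝ k).eval ((x i : ℝ) / 2) = _
    rw [hx, mul_div_cancel_left₀ _ two_ne_zero, T_real_cos, Int.cast_natCast]
    ring_nf
  simp only [hval, integral_scaledChebyshev]
  split_ifs with hk
  · subst hk
    refine tendsto_const_nhds.congr' ?_
    filter_upwards [eventually_ne_atTop 0] with n hn
    simp [hn]
  · exact tendsto_mean_cos (hθ k hk)

end Equidistribution

theorem proposition2p7 {F : Type*} [Field F] [Finite F] (p : ℕ) [Fact p.Prime] [CharP F p]
    (E : WeierstrassCurve F) [E.IsElliptic] (hE : E.IsOrdinary p) :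
    ∃ h : ∀ i : ℕ, E.normalizedTrace p (i + 1) ∈ Set.Icc (-2 : ℝ) 2,
      IsEquidistributed arcsineMeasure fun i : ℕ => ⟨E.normalizedTrace p (i + 1), h i⟩ := by
  have hcos : ∀ i : ℕ, E.normalizedTrace p (i + 1) =
      2 * Real.cos ((i + 1 : ℕ) * E.frobeniusAngle) := fun i => E.normalizedTrace_eq_cos p (i + 1)
  refine ⟨fun i => ?_, isEquidistributed_two_mul_cos
    (fun n hn => hE.cos_mul_frobeniusAngle_ne_one hn) hcos⟩
  rw [hcos, Set.mem_Icc]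
  constructor <;> linarith [Real.neg_one_le_cos ((i + 1 : ℕ) * E.frobeniusAngle),
    Real.cos_le_one ((i + 1 : ℕ) * E.frobeniusAngle)]
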